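/- Let $n\ge 1$, let $v_0\in\mathbb R^n$ be a unit vector, let $\tau,\varepsilon$ be real numbers with $\varepsilon\ge n^{-1/2}$ and $\tau\ge n^{3/4}(\log n)^{1/4}/\varepsilon$, and let $\mathbf T=\tau\cdot v_0^{\otimes 3}+\mathbf A$, where $\mathbf A$ is an $n\times n\times n$ tensor with independent $\mathcal N(0,1)$ entries. Let $C$ be a constant. In the semi-random model an adversary, who sees $\mathbf T$, chooses a matrix $Q\in\mathbb R^{n\times n}$ with $\|Q-\mathrm{Id}\|\le C n^{-1/4}$ (operator norm), and the input is the $3$-tensor $\mathbf T'$ whose $n^2\times n$ flattening (rows indexed by the first two modes) is $TQ$, where $T$ is the corresponding flattening of $\mathbf T$. A degree-$4$ pseudo-expectation is a linear functional $\tilde{\mathbb E}$ on the real polynomials in $x=(x_1,\dots,x_n)$ of degree at most $4$ with $\tilde{\mathbb E}\,1=1$ and $\tilde{\mathbb E}\,p^2\ge 0$ for all $p$ of degree at most $2$; it satisfies $\{\|x\|^2=1\}$ if $\tilde{\mathbb E}\,(\|x\|^2-1)q=0$ whenever $(\|x\|^2-1)q$ has degree at most $4$. The degree-$4$ sum-of-squares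 recovery algorithm, on input $\mathbf T'$, finds a degree-$4$ pseudo-expectation satisfying $\{\|x\|^2=1\}$ that maximizes $\tilde{\mathbb E}\,\mathbf T'(x)$, where $\mathbf T'(x)=\sum_{i,j,k}\mathbf T'_{ijk}x_ix_jx_k$, and outputs $v=\tilde{\mathbb E}x/\|\tilde{\mathbb E}x\|$ (taken to be $0$ if $\tilde{\mathbb E}x=0$). Theorem. There are constants $C',K$ depending only on $C$ such that, for all $n,v_0,\tau,\varepsilon$ as above, with probability at least $1-Kn^{-10}$ over $\mathbf A$ the following holds for every admissible choice of $Q$: a maximizer exists, and for every maximizer the output $v$ of the algorithm satisfies $\langle v,v_0\rangle\ge 1-C'\varepsilon$. -/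

import Mathlib

open MeasureTheory ProbabilityTheory MvPolynomial

noncomputable section

namespace TensorPCA

/-- Real `3`-tensors of side length `n`; the entry at position `(i, j, k)` of `T` is `T (i, j, k)`. -/
abbrev Tensor3 (n : ℕ) : Type := Fin n × Fin n × Fin n → ℝ

/-- The law of a `3`-tensor whose entries are independent standard Gaussians. -/
def gaussianNoise (n : ℕ) : Measure (Tensor3 n) :=
  Measure.pi fun _ => gaussianReal 0 1

/-- The spiked tensor `τ • v₀ ⊗ v₀ ⊗ v₀ + A`. -/
def spikedTensor {n : ℕ} (τ : ℝ) (v₀ : EuclideanSpace ℝ (Fin n)) (A : Tensor3 n) : Tensor3 n :=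
  fun t => τ * (v₀ t.1 * v₀ t.2.1 * v₀ t.2.2) + A t

/-- The `n² × n` matrix flattening of a `3`-tensor: rows are indexed by the first two modes. -/
def flatten {n : ℕ} (T : Tensor3 n) : Matrix (Fin n × Fin n) (Fin n) ℝ :=
  Matrix.of fun r k => T (r.1, r.2, k)

/-- The `3`-tensor with a given `n² × n` matrix flattening. -/
def unflatten {n : ℕ} (M : Matrix (Fin n × Fin n) (Fin n) ℝ) : Tensor3 n :=
  fun t => M (t.1, t.2.1) t.2.2

/-- The operator (`ℓ₂ → ℓ₂`) norm of a square real matrix. -/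
def opNorm {n : ℕ} (M : Matrix (Fin n) (Fin n) ℝ) : ℝ :=
  ‖Matrix.toEuclideanCLM (n := Fin n) (𝕜 := ℝ) M‖

/-- The space `ℝ[x]_{≤ d}` of real polynomials in `x₁, …, xₙ` of total degree at most `d`. -/
abbrev PolyLE (n d : ℕ) : Submodule ℝ (MvPolynomial (Fin n) ℝ) :=
  restrictTotalDegree (Fin n) ℝ d

theorem one_mem_polyLE (n d : ℕ) : (1 : MvPolynomial (Fin n) ℝ) ∈ PolyLE n d := by
  simp [mem_restrictTotalDegree]

theorem X_mem_polyLE {n d : ℕ} (hd : 1 ≤ d) (i : Fin n) :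
    (X i : MvPolynomial (Fin n) ℝ) ∈ PolyLE n d := by
  simpa [mem_restrictTotalDegree] using hd

theorem sq_mem_polyLE {n d : ℕ} {p : MvPolynomial (Fin n) ℝ} (hp : p ∈ PolyLE n (d / 2)) :
    p ^ 2 ∈ PolyLE n d := by
  rw [mem_restrictTotalDegree] at hp ⊢
  have h := totalDegree_pow p 2
  omega

/-- The cubic form `T(x) = ∑ T_{ijk} x_i x_j x_k` of a `3`-tensor, as a polynomial. -/
def tensorPoly {n : ℕ} (T : Tensor3 n) : MvPolynomial (Fin n) ℝ :=
  ∑ i, ∑ j, ∑ k, C (T (i, j, k)) * (X i * X j * X k)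

theorem tensorPoly_mem {n : ℕ} (T : Tensor3 n) : tensorPoly T ∈ PolyLE n 4 := by
  refine Submodule.sum_mem _ fun i _ => Submodule.sum_mem _ fun j _ =>
    Submodule.sum_mem _ fun k _ => ?_
  rw [← smul_eq_C_mul]
  refine Submodule.smul_mem _ _ ?_
  rw [mem_restrictTotalDegree]
  have h1 := totalDegree_mul (X i * X j : MvPolynomial (Fin n) ℝ) (X k)
  have h2 := totalDegree_mul (X i : MvPolynomial (Fin n) ℝ) (X j)
  simp only [totalDegree_X] at h1 h2
  omega

/-- `L` is a degree-`d` pseudo-expectation (`d` even): a linear functional on `ℝ[x]_{≤ d}` with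
`L 1 = 1` that is nonnegative on squares of polynomials of degree at most `d / 2`. -/
structure IsPseudoExpectation {n d : ℕ} (L : PolyLE n d →ₗ[ℝ] ℝ) : Prop where
  map_one : L ⟨1, one_mem_polyLE n d⟩ = 1
  map_sq_nonneg : ∀ (p : MvPolynomial (Fin n) ℝ) (hp : p ∈ PolyLE n (d / 2)),
    0 ≤ L ⟨p ^ 2, sq_mem_polyLE hp⟩

/-- `L` satisfies the constraint `{p(x) = 0}`. -/
def Satisfies {n d : ℕ} (L : PolyLE n d →ₗ[ℝ] ℝ) (p : MvPolynomial (Fin n) ℝ) : Prop :=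
  ∀ (q : MvPolynomial (Fin n) ℝ) (h : p * q ∈ PolyLE n d), L ⟨p * q, h⟩ = 0

/-- The polynomial `‖x‖² - 1`. -/
def spherePoly (n : ℕ) : MvPolynomial (Fin n) ℝ := (∑ i, X i ^ 2) - 1

/-- Feasible points of the degree-`4` sum-of-squares relaxation over the unit sphere. -/
def IsFeasible {n : ℕ} (L : PolyLE n 4 →ₗ[ℝ] ℝ) : Prop :=
  IsPseudoExpectation L ∧ Satisfies L (spherePoly n)

/-- `L` maximizes the pseudo-expectation of `T(x)` among the degree-`4` pseudo-expectations that
satisfy `{‖x‖² = 1}`. -/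
def IsMaximizer {n : ℕ} (T : Tensor3 n) (L : PolyLE n 4 →ₗ[ℝ] ℝ) : Prop :=
  IsFeasible L ∧ ∀ L' : PolyLE n 4 →ₗ[ℝ] ℝ, IsFeasible L' →
    L' ⟨tensorPoly T, tensorPoly_mem T⟩ ≤ L ⟨tensorPoly T, tensorPoly_mem T⟩

/-- The vector of pseudo-expectations of the coordinates of `x`. -/
def pseudoMean {n : ℕ} (L : PolyLE n 4 →ₗ[ℝ] ℝ) : EuclideanSpace ℝ (Fin n) :=
  WithLp.toLp 2 fun i => L ⟨X i, X_mem_polyLE (by norm_num) i⟩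

/-- `v` is a possible output of the degree-`4` sum-of-squares recovery algorithm on input `T`:
the normalized pseudo-mean of some maximizer. A vanishing pseudo-mean counts as output `0`. -/
def IsRecoveryOutput {n : ℕ} (T : Tensor3 n) (v : EuclideanSpace ℝ (Fin n)) : Prop :=
  ∃ L : PolyLE n 4 →ₗ[ℝ] ℝ, IsMaximizer T L ∧ v = ‖pseudoMean L‖⁻¹ • pseudoMean L

/-- The input in the semi-random model: the `3`-tensor whose flattening is `T Q`, where `T` is the
flattening of the spiked tensor. -/
def semiRandomInput {n : ℕ} (τ : ℝ) (v₀ : EuclideanSpace ℝ (Fin n)) (A : Tensor3 n)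
    (Q : Matrix (Fin n) (Fin n) ℝ) : Tensor3 n :=
  unflatten (flatten (spikedTensor τ v₀ A) * Q)

end TensorPCA

end

/-! Write `t = ⟨v₀, x⟩` and let `A_l` be the slices of the noise. The input cubic is `τ t² ⟨Qᵀv₀, x⟩
+ ∑ A_l(x) (Qx)_l`. The maximizer must do at least as well as evaluation at `v₀`, so the proof needs
a noise bound uniform over all pseudo-expectations and all `Q`, and a signal bound that forces `L t`
to be close to `1`.

Noise. Cauchy–Schwarz for pseudo-expectations (`abs_noise_le`) separates `Q` from `A`, leaving the
energy `L ∑ A_l(x)²`, which does not involve `Q`. With high probability it is `O(n^{3/2})` for every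
`L` (`energy_tail`), by decoupling. For an independent copy `A'`, the difference of energies is `∑
L((A - A')_l (A + A')_l)`, and up to scaling `A - A'` and `A + A'` are independent Gaussian tensors
`G`, `H`. Since pseudo-moments are symmetric in the indices, this sum is at most the norm of `∑ G_l
⊗ H_l`, which a net argument bounds by `O(n^{3/2})`. For fixed `L` the energy of `A'` has mean `n`,
so Markov's inequality supplies an `A'` of energy below `4n`. This `A'` may depend on `L`, but the
exceptional set of `A` does not.

Signal. Put `d = Qᵀv₀ - v₀`, with `‖d‖ ≤ δ = O(n^{-1/4})`. The part of `d` along `v₀` changes the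
value at `v₀` and the upper bound by the same factor. The orthogonal part pairs with the component
of `x` orthogonal to `v₀`, whose pseudo-variance is at most `2 (1 - L t)`. The loss is therefore a
small multiple of `1 - L t` plus `O(δ²)` (`map_signal_le`). This second-order error is `O(n^{-1/2})
= O(ε)`, and the noise contributes `O(n^{3/4} / τ) = O(ε)`. -/

namespace TensorPCA

/-- The Euclidean norm of a finite family of reals. -/
noncomputable def l2 {ι : Type*} [Fintype ι] (x : ι → ℝ) : ℝ := √(∑ i, x i ^ 2)

/-! ### Nets of Euclidean balls and Gaussian tails of linear forms. -/

section Nets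

variable {ι : Type*} [Fintype ι]

theorem l2_nonneg (x : ι → ℝ) : 0 ≤ l2 x := Real.sqrt_nonneg _

theorem sq_l2 (x : ι → ℝ) : l2 x ^ 2 = ∑ i, x i ^ 2 :=
  Real.sq_sqrt (Finset.sum_nonneg fun _ _ => sq_nonneg _)

theorem l2_eq_norm (x : ι → ℝ) : l2 x = ‖WithLp.toLp 2 x‖ := by
  simp [l2, EuclideanSpace.norm_eq]

theorem sum_mul_le_l2 (x y : ι → ℝ) : ∑ i, x i * y i ≤ l2 x * l2 y :=
  Real.sum_mul_le_sqrt_mul_sqrt _ _ _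

/-- A finite-dimensional Euclidean space has a `1/2`-net of the unit ball with at most `5 ^ dim`
points. -/
theorem exists_net_euclidean (ι : Type*) [Fintype ι] :
    ∃ s : Finset (EuclideanSpace ℝ ι), s.card ≤ 5 ^ Fintype.card ι ∧ (∀ x ∈ s, ‖x‖ ≤ 1) ∧
      ∀ y : EuclideanSpace ℝ ι, ‖y‖ ≤ 1 → ∃ x ∈ s, ‖y - x‖ ≤ 1 / 2 := by
  classical
  let P : Finset (EuclideanSpace ℝ ι) → Prop := fun s =>
    (∀ c ∈ s, ‖c‖ ≤ 2) ∧ ∀ c ∈ s, ∀ d ∈ s, c ≠ d → 1 ≤ ‖c - d‖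
  have hcard : ∀ s, P s → s.card ≤ 5 ^ Fintype.card ι := fun s hs => by
    simpa using Besicovitch.card_le_of_separated s hs.1 hs.2
  -- Minimizing this deficit produces a `1`-separated subset of the ball of radius `2` of maximal
  -- cardinality; halving it gives the net.
  have hne : ∃ k, ∃ s, P s ∧ 5 ^ Fintype.card ι - s.card = k := ⟨_, ∅, by simp [P], rfl⟩
  obtain ⟨s, hs, hsk⟩ := Nat.find_spec hne
  have hmin : ∀ t, P t → t.card ≤ s.card := fun t ht => by
    have h1 := Nat.find_min' hne ⟨t, ht, rfl⟩
    have h2 := hcard t ht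
    have h3 := hcard s hs
    omega
  refine ⟨s.image fun x => (1 / 2 : ℝ) • x, Finset.card_image_le.trans (hcard s hs), ?_, ?_⟩
  · intro x hx
    obtain ⟨c, hc, rfl⟩ := Finset.mem_image.1 hx
    have := hs.1 c hc
    rw [norm_smul]
    norm_num
    linarith
  · intro y hy
    by_contra! hcon
    have hfar : ∀ c ∈ s, 1 < ‖(2 : ℝ) • y - c‖ := fun c hc => by
      have h1 := hcon _ (Finset.mem_image_of_mem _ hc)
      have h2 : (2 : ℝ) • y - c = (2 : ℝ) • (y - (1 / 2 : ℝ) • c) := by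
        rw [smul_sub, smul_smul]; norm_num
      rw [h2, norm_smul]
      norm_num at h1 ⊢
      linarith
    have hnot : (2 : ℝ) • y ∉ s := fun h => by
      have := hfar _ h
      simp at this
      linarith
    have hP : P (insert ((2 : ℝ) • y) s) := by
      refine ⟨fun c hc => ?_, fun c hc d hd hcd => ?_⟩
      · rcases Finset.mem_insert.1 hc with rfl | hc
        · rw [norm_smul]; norm_num; linarith
        · exact hs.1 c hc
      · rcases Finset.mem_insert.1 hc with rfl | hc' <;> rcases Finset.mem_insert.1 hd with rfl | hd'
        · exact absurd rfl hcd
        · exact (hfar d hd').le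
        · rw [norm_sub_rev]; exact (hfar c hc').le
        · exact hs.2 c hc' d hd' hcd
    have := hmin _ hP
    rw [Finset.card_insert_of_notMem hnot] at this
    omega

theorem IsLinearMap.apply_eq_sum [DecidableEq ι] {f : (ι → ℝ) → ℝ} (hf : IsLinearMap ℝ f)
    (x : ι → ℝ) : f x = ∑ i, f (Pi.single i 1) * x i := by
  have h := LinearMap.pi_apply_eq_sum_univ (hf.mk' f) x
  simp only [IsLinearMap.mk'_apply, smul_eq_mul] at h
  rw [h]
  refine Finset.sum_congr rfl fun i _ => ?_
  rw [mul_comm]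
  congr 2
  ext j
  simp [Pi.single_apply, eq_comm]

/-- A net of the unit ball detects the norm of linear functionals up to a factor `2`. -/
theorem exists_net (ι : Type*) [Fintype ι] :
    ∃ s : Finset (ι → ℝ), s.card ≤ 5 ^ Fintype.card ι ∧ (∀ x ∈ s, l2 x ≤ 1) ∧
      ∀ (f : (ι → ℝ) → ℝ) (t : ℝ), IsLinearMap ℝ f → (∀ x ∈ s, |f x| ≤ t) →
        ∀ y, |f y| ≤ 2 * t * l2 y := by
  classical
  obtain ⟨s, hs, hs1, hs2⟩ := exists_net_euclidean ι
  refine ⟨s.image WithLp.ofLp, Finset.card_image_le.trans hs, ?_, ?_⟩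
  · intro x hx
    obtain ⟨c, hc, rfl⟩ := Finset.mem_image.1 hx
    rw [l2_eq_norm]
    exact hs1 c hc
  · intro f t hf hft y
    set ξ : EuclideanSpace ℝ ι := WithLp.toLp 2 fun i => f (Pi.single i 1) with hξ
    have hfx : ∀ x : EuclideanSpace ℝ ι, f x.ofLp = inner ℝ ξ x := fun x => by
      rw [IsLinearMap.apply_eq_sum hf]
      simp [PiLp.inner_apply, hξ, mul_comm]
    have hft' : ∀ x ∈ s, |inner ℝ ξ x| ≤ t := fun x hx => by
      rw [← hfx]; exact hft _ (Finset.mem_image_of_mem _ hx)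
    have hnorm : ‖ξ‖ ≤ 2 * t := by
      by_cases h0 : ‖ξ‖ = 0
      · obtain ⟨x, hx, -⟩ := hs2 0 (by simp)
        have := (abs_nonneg _).trans (hft' x hx)
        linarith
      -- The functional attains its norm at `ξ / ‖ξ‖`; moving to a net point costs at most `‖ξ‖ /
      -- 2`, so `‖ξ‖ ≤ t + ‖ξ‖ / 2`.
      obtain ⟨x, hx, hx2⟩ := hs2 (‖ξ‖⁻¹ • ξ) (by
        rw [norm_smul, norm_inv, norm_norm, inv_mul_cancel₀ h0])
      have h1 : inner ℝ ξ (‖ξ‖⁻¹ • ξ) = ‖ξ‖ := by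
        rw [real_inner_smul_right, real_inner_self_eq_norm_sq]
        field_simp
      have h2 := real_inner_le_norm ξ (‖ξ‖⁻¹ • ξ - x)
      rw [inner_sub_right, h1] at h2
      have h3 := mul_le_mul_of_nonneg_left hx2 (norm_nonneg ξ)
      have h4 := (le_abs_self _).trans (hft' x hx)
      linarith
    have h5 : f y = inner ℝ ξ (WithLp.toLp 2 y) := hfx (WithLp.toLp 2 y)
    rw [h5, l2_eq_norm]
    exact (abs_real_inner_le_norm _ _).trans
      (mul_le_mul_of_nonneg_right hnorm (norm_nonneg _))

/-- Independent sub-Gaussian terms add their variance proxies, so the Chernoff bound applies to each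
sign. Allowing any `σ2` above the true variance covers the degenerate case `c = 0`. -/
theorem gaussian_tail (c : ι → ℝ) {σ2 t : ℝ} (hσ : 0 < σ2) (ht : 0 ≤ t)
    (hc : ∑ i, c i ^ 2 ≤ σ2) :
    (Measure.pi fun _ : ι => gaussianReal 0 1) {A | t < |∑ i, A i * c i|} ≤
      ENNReal.ofReal (2 * Real.exp (-t ^ 2 / (2 * σ2))) := by
  set γ : Measure (ι → ℝ) := Measure.pi fun _ : ι => gaussianReal 0 1 with hγ
  have hid : HasSubgaussianMGF id 1 (gaussianReal 0 1) :=
    ⟨fun u => by simpa using integrable_exp_mul_gaussianReal u,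
      fun u => by simp [mgf_id_gaussianReal]⟩
  have hone : ∀ (c : ι → ℝ), ∑ i, c i ^ 2 ≤ σ2 →
      γ.real {A | t ≤ ∑ i, A i * c i} ≤ Real.exp (-t ^ 2 / (2 * σ2)) := by
    intro c hc
    have hind : iIndepFun (fun i (A : ι → ℝ) => A i * c i) γ :=
      iIndepFun_pi (X := fun i a => a * c i) fun i => by fun_prop
    have hsub : ∀ i ∈ Finset.univ, HasSubgaussianMGF (fun A : ι → ℝ => A i * c i)
        ((c i ^ 2).toNNReal) γ := fun i _ => by
      have h1 : HasSubgaussianMGF (fun A : ι → ℝ => A i) 1 γ := by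
        refine HasSubgaussianMGF.of_map (Y := fun A : ι → ℝ => A i) (X := id)
          (measurable_pi_apply i).aemeasurable ?_
        rw [hγ, (measurePreserving_eval _ i).map_eq]
        exact hid
      have h2 := h1.const_mul (c i)
      have h3 : (⟨c i ^ 2, sq_nonneg _⟩ : NNReal) = (c i ^ 2).toNNReal :=
        (Real.toNNReal_of_nonneg (sq_nonneg _)).symm
      rw [h3, mul_one] at h2
      simpa only [mul_comm] using h2
    have hsum := HasSubgaussianMGF.sum_of_iIndepFun hind hsub
    have hsum' : HasSubgaussianMGF (fun A : ι → ℝ => ∑ i, A i * c i) σ2.toNNReal γ := by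
      refine ⟨hsum.integrable_exp_mul, fun u => (hsum.mgf_le u).trans (Real.exp_le_exp.2 ?_)⟩
      rw [NNReal.coe_sum, Real.coe_toNNReal _ hσ.le]
      simp only [Real.coe_toNNReal _ (sq_nonneg _)]
      gcongr
    have h5 := hsum'.measure_ge_le ht
    rwa [Real.coe_toNNReal _ hσ.le] at h5
  have hsub : {A : ι → ℝ | t < |∑ i, A i * c i|} ⊆
      {A | t ≤ ∑ i, A i * c i} ∪ {A | t ≤ ∑ i, A i * -c i} := by
    intro A hA
    rcases lt_abs.1 (show t < |∑ i, A i * c i| from hA) with h | h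
    · exact Or.inl h.le
    · refine Or.inr ?_
      simpa [Finset.sum_neg_distrib] using h.le
  have h1 := hone c hc
  have h2 := hone (fun i => -c i) (by simpa using hc)
  rw [← ofReal_measureReal]
  refine ENNReal.ofReal_le_ofReal ((measureReal_mono hsub).trans
    ((measureReal_union_le _ _).trans ?_))
  linarith

end Nets
-- Norms of a Gaussian tensor and of the matrix of two independent ones.
section Concentration

variable {n : ℕ}

instance : IsProbabilityMeasure (gaussianNoise n) := by
  unfold gaussianNoise; infer_instance

/-- The trilinear form of a `3`-tensor. -/
noncomputable def triForm (H : Tensor3 n) (u v z : Fin n → ℝ) : ℝ :=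
  ∑ p : Fin n × Fin n × Fin n, H p * (u p.1 * v p.2.1 * z p.2.2)

/-- The tensor with slices `X H_k Yᵀ`, where `H_k` are the slices of `H`. -/
noncomputable def slicesMul (H : Tensor3 n) (X Y : Fin n × Fin n → ℝ) : Tensor3 n :=
  fun p => ∑ q : Fin n × Fin n, H (q.1, q.2, p.2.2) * (X (p.1, q.1) * Y (p.2.1, q.2))

/-- The bilinear form of the matrix `∑ k, G_k ⊗ H_k` evaluated at `X` and `Y`. -/
noncomputable def crossForm (G H : Tensor3 n) (X Y : Fin n × Fin n → ℝ) : ℝ :=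
  ∑ p, G p * slicesMul H X Y p

theorem isLinearMap_triForm₁ (H : Tensor3 n) (v z : Fin n → ℝ) :
    IsLinearMap ℝ fun u => triForm H u v z :=
  ⟨fun x y => by simp only [triForm, ← Finset.sum_add_distrib, Pi.add_apply]; congr! 1; ring,
    fun c x => by
      simp only [triForm, smul_eq_mul, Finset.mul_sum, Pi.smul_apply]; congr! 1; ring⟩

theorem isLinearMap_triForm₂ (H : Tensor3 n) (u z : Fin n → ℝ) :
    IsLinearMap ℝ fun v => triForm H u v z :=
  ⟨fun x y => by simp only [triForm, ← Finset.sum_add_distrib, Pi.add_apply]; congr! 1; ring,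
    fun c x => by
      simp only [triForm, smul_eq_mul, Finset.mul_sum, Pi.smul_apply]; congr! 1; ring⟩

theorem isLinearMap_triForm₃ (H : Tensor3 n) (u v : Fin n → ℝ) :
    IsLinearMap ℝ fun z => triForm H u v z :=
  ⟨fun x y => by simp only [triForm, ← Finset.sum_add_distrib, Pi.add_apply]; congr! 1; ring,
    fun c x => by
      simp only [triForm, smul_eq_mul, Finset.mul_sum, Pi.smul_apply]; congr! 1; ring⟩

theorem isLinearMap_crossForm_left (G H : Tensor3 n) (Y : Fin n × Fin n → ℝ) :
    IsLinearMap ℝ fun X => crossForm G H X Y :=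
  ⟨fun x y => by
      simp only [crossForm, slicesMul, ← Finset.sum_add_distrib, ← mul_add, Pi.add_apply, add_mul],
    fun c x => by
      simp only [crossForm, slicesMul, smul_eq_mul, Finset.mul_sum, Pi.smul_apply]
      congr! 2; ring⟩

theorem isLinearMap_crossForm_right (G H : Tensor3 n) (X : Fin n × Fin n → ℝ) :
    IsLinearMap ℝ fun Y => crossForm G H X Y :=
  ⟨fun x y => by
      simp only [crossForm, slicesMul, ← Finset.sum_add_distrib, ← mul_add, Pi.add_apply],
    fun c x => by
      simp only [crossForm, slicesMul, smul_eq_mul, Finset.mul_sum, Pi.smul_apply]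
      congr! 2; ring⟩

/-- The left side is the variance of `crossForm G H X Y` over Gaussian `G`. For each `(i, j)` the
fibre `z = slicesMul H X Y (i, j, ·)` is tested against itself: `triForm H X_i Y_j z = ‖z‖²`, hence
`‖z‖ ≤ m ‖X_i‖ ‖Y_j‖`. Summing over rows finishes. -/
theorem sum_sq_slicesMul_le (H : Tensor3 n) {m : ℝ} (hm : 0 ≤ m)
    (h : ∀ u v z, |triForm H u v z| ≤ m * l2 u * l2 v * l2 z) (X Y : Fin n × Fin n → ℝ) :
    ∑ p, slicesMul H X Y p ^ 2 ≤ m ^ 2 * (l2 X ^ 2 * l2 Y ^ 2) := by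
  have key : ∀ i j, ∑ k, slicesMul H X Y (i, j, k) ^ 2 ≤
      m ^ 2 * ((∑ a, X (i, a) ^ 2) * ∑ b, Y (j, b) ^ 2) := by
    intro i j
    set z : Fin n → ℝ := fun k => slicesMul H X Y (i, j, k) with hz
    set u : Fin n → ℝ := fun a => X (i, a)
    set v : Fin n → ℝ := fun b => Y (j, b)
    have h1 : triForm H u v z = l2 z ^ 2 := by
      rw [sq_l2, triForm, Fintype.sum_prod_type]
      simp only [Fintype.sum_prod_type, hz, slicesMul, u, v]
      have : ∀ x : Fin n, ∑ y, ∑ k, H (x, y, k) * (X (i, x) * Y (j, y) *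
          ∑ a, ∑ b, H (a, b, k) * (X (i, a) * Y (j, b))) = ∑ k, ∑ y, H (x, y, k) * (X (i, x) * Y (j, y) *
          ∑ a, ∑ b, H (a, b, k) * (X (i, a) * Y (j, b))) := fun x => Finset.sum_comm
      simp_rw [this]
      rw [Finset.sum_comm]
      refine Finset.sum_congr rfl fun k _ => ?_
      simp_rw [sq, Finset.sum_mul, ← mul_assoc]
    have h2 := (le_abs_self _).trans (h u v z)
    rw [h1] at h2
    have h3 : l2 z ≤ m * l2 u * l2 v := by
      by_contra! hcon
      have h4 : 0 ≤ m * l2 u * l2 v := by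
        have := l2_nonneg u; have := l2_nonneg v; positivity
      nlinarith
    calc ∑ k, z k ^ 2 = l2 z ^ 2 := (sq_l2 z).symm
      _ ≤ (m * l2 u * l2 v) ^ 2 := pow_le_pow_left₀ (l2_nonneg _) h3 2
      _ = m ^ 2 * (l2 u ^ 2 * l2 v ^ 2) := by ring
      _ = _ := by rw [sq_l2, sq_l2]
  rw [sq_l2, sq_l2, Fintype.sum_prod_type, Fintype.sum_prod_type, Fintype.sum_prod_type,
    Finset.sum_mul_sum, Finset.mul_sum]
  refine Finset.sum_le_sum fun i _ => ?_
  rw [Fintype.sum_prod_type, Finset.mul_sum]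
  exact Finset.sum_le_sum fun j _ => key i j

theorem five_pow_le_exp (k : ℕ) : (5 : ℝ) ^ k ≤ Real.exp (2 * k) := by
  have h : (5 : ℝ) ≤ Real.exp 2 := by
    have := Real.exp_one_gt_d9
    rw [show (2 : ℝ) = 1 + 1 by norm_num, Real.exp_add]
    nlinarith
  calc (5 : ℝ) ^ k ≤ Real.exp 2 ^ k := pow_le_pow_left₀ (by norm_num) h k
    _ = Real.exp (2 * k) := by rw [← Real.exp_nat_mul]; ring_nf

theorem measure_biUnion_le_card_mul {Ω α : Type*} [MeasurableSpace Ω] (μ : Measure Ω)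
    (s : Finset α) (f : α → Set Ω) {N b : ℝ} (hN : (s.card : ℝ) ≤ N) (hb : 0 ≤ b)
    (h : ∀ a ∈ s, μ (f a) ≤ ENNReal.ofReal b) :
    μ (⋃ a ∈ s, f a) ≤ ENNReal.ofReal (N * b) := by
  refine (measure_biUnion_finset_le s f).trans ((Finset.sum_le_sum h).trans ?_)
  rw [Finset.sum_const, nsmul_eq_mul, ← ENNReal.ofReal_natCast,
    ← ENNReal.ofReal_mul (Nat.cast_nonneg _)]
  exact ENNReal.ofReal_le_ofReal (mul_le_mul_of_nonneg_right hN hb)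

/-- The injective norm of a Gaussian tensor is `O(√n)` with overwhelming probability. -/
theorem injective_norm_tail (hn : 1 ≤ n) :
    ∃ S : Set (Tensor3 n), MeasurableSet S ∧
      gaussianNoise n S ≤ ENNReal.ofReal (2 * Real.exp (-(2 * n))) ∧
      ∀ H ∉ S, ∀ u v z, |triForm H u v z| ≤ 32 * √n * l2 u * l2 v * l2 z := by
  classical
  obtain ⟨s, hcard, hs1, hs⟩ := exists_net (Fin n)
  rw [Fintype.card_fin] at hcard
  let f : (Fin n → ℝ) × (Fin n → ℝ) × (Fin n → ℝ) → Set (Tensor3 n) := fun w =>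
    {H | 4 * √n < |triForm H w.1 w.2.1 w.2.2|}
  have hn0 : (0 : ℝ) < n := by exact_mod_cast hn
  refine ⟨⋃ w ∈ s ×ˢ s ×ˢ s, f w, ?_, ?_, ?_⟩
  · refine Finset.measurableSet_biUnion _ fun w _ => ?_
    refine measurableSet_lt measurable_const ?_
    unfold triForm
    fun_prop
  · have hN : ((s ×ˢ s ×ˢ s).card : ℝ) ≤ Real.exp (6 * n) := by
      have h1 : (s ×ˢ s ×ˢ s).card ≤ 5 ^ (n + (n + n)) := by
        rw [Finset.card_product, Finset.card_product, pow_add, pow_add]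
        gcongr
      calc ((s ×ˢ s ×ˢ s).card : ℝ) ≤ (5 : ℝ) ^ (n + (n + n)) := by exact_mod_cast h1
        _ ≤ _ := five_pow_le_exp _
        _ = _ := by push_cast; ring_nf
    refine (measure_biUnion_le_card_mul (b := 2 * Real.exp (-(8 * n))) _ _ _ hN (by positivity)
      fun w hw => ?_).trans_eq ?_
    · simp only [Finset.mem_product] at hw
      have h1 := gaussian_tail (fun p : Fin n × Fin n × Fin n => w.1 p.1 * w.2.1 p.2.1 * w.2.2 p.2.2)
        (σ2 := 1) (t := 4 * √n) one_pos (by positivity) (by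
          have e : ∑ p : Fin n × Fin n × Fin n, (w.1 p.1 * w.2.1 p.2.1 * w.2.2 p.2.2) ^ 2 =
              l2 w.1 ^ 2 * (l2 w.2.1 ^ 2 * l2 w.2.2 ^ 2) := by
            simp only [sq_l2, Fintype.sum_prod_type, Finset.sum_mul_sum, mul_pow]
            simp only [Finset.mul_sum, mul_assoc]
          rw [e]
          have h1 := pow_le_one₀ (n := 2) (l2_nonneg w.1) (hs1 _ hw.1)
          have h2 := pow_le_one₀ (n := 2) (l2_nonneg w.2.1) (hs1 _ hw.2.1)
          have h3 := pow_le_one₀ (n := 2) (l2_nonneg w.2.2) (hs1 _ hw.2.2)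
          exact mul_le_one₀ h1 (by positivity) (mul_le_one₀ h2 (by positivity) h3))
      have e : -(4 * √(n : ℝ)) ^ 2 / (2 * 1) = -(8 * n) := by
        rw [mul_pow, Real.sq_sqrt hn0.le]; ring
      rw [e] at h1
      exact h1
    · congr 1
      rw [mul_left_comm, ← Real.exp_add]
      ring_nf
  · intro H hH u v z
    have h0 : ∀ x ∈ s, ∀ y ∈ s, ∀ w ∈ s, |triForm H x y w| ≤ 4 * √n := by
      intro x hx y hy w hw
      by_contra! hcon
      exact hH (Set.mem_biUnion (x := (x, y, w)) (by simp [hx, hy, hw]) hcon)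
    -- The arguments leave the net one at a time, each at the cost of a factor `2`; this turns `4`
    -- into `32`.
    have h1 : ∀ x ∈ s, ∀ y ∈ s, ∀ w, |triForm H x y w| ≤ 2 * (4 * √n) * l2 w :=
      fun x hx y hy => hs _ _ (isLinearMap_triForm₃ H x y) (h0 x hx y hy)
    have h2 : ∀ x ∈ s, ∀ w y, |triForm H x y w| ≤ 2 * (2 * (4 * √n) * l2 w) * l2 y :=
      fun x hx w => hs _ _ (isLinearMap_triForm₂ H x w) fun y hy => h1 x hx y hy w
    have h3 := hs _ _ (isLinearMap_triForm₁ H v z) (fun x hx => h2 x hx z v) u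
    linarith

/-- The matrix `∑ k, G_k ⊗ H_k` built from independent Gaussian tensors `G`, `H` has norm
`O(n ^ (3 / 2))` with overwhelming probability. -/
theorem crossForm_tail (hn : 1 ≤ n) :
    ∃ E : Set (Tensor3 n × Tensor3 n), MeasurableSet E ∧
      (gaussianNoise n).prod (gaussianNoise n) E ≤ ENNReal.ofReal (4 * Real.exp (-(2 * n))) ∧
      ∀ G H, (G, H) ∉ E → ∀ X Y, |crossForm G H X Y| ≤ 512 * (n * √n) * l2 X * l2 Y := by
  classical
  obtain ⟨S, hSm, hS, hSn⟩ := injective_norm_tail hn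
  obtain ⟨s, hcard, hs1, hs⟩ := exists_net (Fin n × Fin n)
  rw [Fintype.card_prod, Fintype.card_fin] at hcard
  have hn0 : (0 : ℝ) < n := by exact_mod_cast hn
  have hn1 : (1 : ℝ) ≤ n := by exact_mod_cast hn
  let f : Tensor3 n → (Fin n × Fin n → ℝ) × (Fin n × Fin n → ℝ) → Set (Tensor3 n) := fun H w =>
    {G | 128 * (n * √n) < |crossForm G H w.1 w.2|}
  let F : Set (Tensor3 n × Tensor3 n) := {P | P.2 ∉ S ∧ P.1 ∈ ⋃ w ∈ s ×ˢ s, f P.2 w}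
  have hFm : MeasurableSet F := by
    have : F = Prod.snd ⁻¹' Sᶜ ∩ ⋃ w ∈ s ×ˢ s,
        {P : Tensor3 n × Tensor3 n | 128 * (n * √n) < |crossForm P.1 P.2 w.1 w.2|} := by
      ext P
      simp [F, f]
    rw [this]
    refine (measurable_snd hSm.compl).inter (Finset.measurableSet_biUnion _ fun w _ => ?_)
    refine measurableSet_lt measurable_const ?_
    unfold crossForm slicesMul
    fun_prop
  have hF : (gaussianNoise n).prod (gaussianNoise n) F ≤
      ENNReal.ofReal (2 * Real.exp (-(2 * n))) := by
    rw [Measure.prod_apply_symm hFm]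
    refine (lintegral_mono (g := fun _ => ENNReal.ofReal (2 * Real.exp (-(2 * n))))
      fun H => ?_).trans_eq (by simp)
    by_cases hH : H ∈ S
    · have : (fun G => (G, H)) ⁻¹' F = ∅ := by ext G; simp [F, hH]
      simp [this]
    have : (fun G => (G, H)) ⁻¹' F = ⋃ w ∈ s ×ˢ s, f H w := by ext G; simp [F, hH]
    rw [this]
    have hN : ((s ×ˢ s).card : ℝ) ≤ Real.exp (4 * n ^ 2) := by
      have h1 : (s ×ˢ s).card ≤ 5 ^ (n * n + n * n) := by
        rw [Finset.card_product, pow_add]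
        gcongr
      calc ((s ×ˢ s).card : ℝ) ≤ (5 : ℝ) ^ (n * n + n * n) := by exact_mod_cast h1
        _ ≤ _ := five_pow_le_exp _
        _ = _ := by push_cast; ring_nf
    refine (measure_biUnion_le_card_mul (b := 2 * Real.exp (-(8 * n ^ 2))) _ _ _ hN (by positivity)
      fun w hw => ?_).trans (ENNReal.ofReal_le_ofReal ?_)
    · simp only [Finset.mem_product] at hw
      -- With `H` fixed the form is Gaussian in `G`, with variance at most `(32√n)² = 1024n`. The
      -- threshold makes the exponent `8n²`, which beats the entropy `4n²` of pairs of points in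
      -- dimension `n²`.
      have h1 := gaussian_tail (slicesMul H w.1 w.2)
        (σ2 := 1024 * n) (t := 128 * (n * √n)) (by positivity) (by positivity) (by
          refine (sum_sq_slicesMul_le H (m := 32 * √n) (by positivity) (hSn H hH) _ _).trans ?_
          have h1 := pow_le_one₀ (n := 2) (l2_nonneg w.1) (hs1 _ hw.1)
          have h2 := pow_le_one₀ (n := 2) (l2_nonneg w.2) (hs1 _ hw.2)
          have h3 := mul_le_one₀ h1 (by positivity) h2
          rw [mul_pow, Real.sq_sqrt hn0.le]
          nlinarith)
      have e : -(128 * (n * √(n : ℝ))) ^ 2 / (2 * (1024 * n)) = -(8 * n ^ 2) := by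
        rw [mul_pow, mul_pow, Real.sq_sqrt hn0.le]; field_simp; ring
      rw [e] at h1
      exact h1
    · rw [mul_left_comm, ← Real.exp_add]
      gcongr
      nlinarith
  refine ⟨Prod.snd ⁻¹' S ∪ F, (measurable_snd hSm).union hFm, ?_, ?_⟩
  · refine (measure_union_le _ _).trans ?_
    have h1 : (gaussianNoise n).prod (gaussianNoise n) (Prod.snd ⁻¹' S) = gaussianNoise n S := by
      rw [← Set.univ_prod, Measure.prod_prod]; simp
    rw [h1]
    refine (add_le_add hS hF).trans_eq ?_
    rw [← ENNReal.ofReal_add (by positivity) (by positivity)]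
    ring_nf
  · intro G H hGH X Y
    have hH : H ∉ S := fun h => hGH (Or.inl h)
    have h0 : ∀ x ∈ s, ∀ y ∈ s, |crossForm G H x y| ≤ 128 * (n * √n) := by
      intro x hx y hy
      by_contra! hcon
      exact hGH (Or.inr ⟨hH, Set.mem_biUnion (x := (x, y)) (by simp [hx, hy]) hcon⟩)
    have h1 : ∀ x ∈ s, ∀ y, |crossForm G H x y| ≤ 2 * (128 * (n * √n)) * l2 y :=
      fun x hx => hs _ _ (isLinearMap_crossForm_right G H x) (h0 x hx)
    have h2 := hs _ _ (isLinearMap_crossForm_left G H Y) (fun x hx => h1 x hx Y) X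
    linarith

end Concentration
-- Rotation invariance and a decoupled partner.
section Decoupling

variable {n : ℕ}

theorem integrable_mul_gaussianNoise (p q : Fin n × Fin n × Fin n) :
    Integrable (fun A => A p * A q) (gaussianNoise n) ∧
      ∫ A, A p * A q ∂gaussianNoise n = if p = q then 1 else 0 := by
  have hmem : ∀ p, MemLp (fun A : Tensor3 n => A p) 2 (gaussianNoise n) := fun p => by
    have h := (memLp_id_gaussianReal (μ := 0) (v := 1) 2).comp_measurePreserving
      (measurePreserving_eval (fun _ : Fin n × Fin n × Fin n => gaussianReal 0 1) p)
    exact h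
  have hmean : ∀ p, ∫ A, A p ∂gaussianNoise n = 0 := fun p => by
    have h1 := integral_comp_eval (μ := fun _ : Fin n × Fin n × Fin n => gaussianReal 0 1)
      (i := p) (f := fun x : ℝ => x) (by fun_prop)
    rw [gaussianNoise, h1, integral_id_gaussianReal]
  have hvar : ∫ A, A p * A p ∂gaussianNoise n = 1 := by
    have h1 := integral_comp_eval (μ := fun _ : Fin n × Fin n × Fin n => gaussianReal 0 1)
      (i := p) (f := fun x : ℝ => x * x) (by fun_prop)
    rw [gaussianNoise, h1]
    have h2 := variance_id_gaussianReal (μ := 0) (v := 1)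
    rw [variance_of_integral_eq_zero (by fun_prop) (by simp)] at h2
    simpa [sq] using h2
  refine ⟨(hmem p).integrable_mul (hmem q), ?_⟩
  split_ifs with h
  · subst h; exact hvar
  · have hind : iIndepFun (fun i (A : Tensor3 n) => A i) (gaussianNoise n) :=
      iIndepFun_pi (X := fun _ a => a) fun i => by fun_prop
    have h1 := (hind.indepFun h).integral_fun_mul_eq_mul_integral
      (hmem p).aestronglyMeasurable (hmem q).aestronglyMeasurable
    rw [h1, hmean, zero_mul]

/-- A pair of independent copies of a centred Gaussian law is rotation invariant. Gaussianity is
transported from the standard Gaussian on Euclidean space, since `Tensor3` carries the sup norm. -/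
theorem map_rotation_gaussianNoise (θ : ℝ) :
    ((gaussianNoise n).prod (gaussianNoise n)).map (ContinuousLinearMap.rotation θ) =
      (gaussianNoise n).prod (gaussianNoise n) := by
  have hmap : gaussianNoise n = (stdGaussian (EuclideanSpace ℝ (Fin n × Fin n × Fin n))).map
      (EuclideanSpace.equiv (Fin n × Fin n × Fin n) ℝ) := by
    rw [← map_pi_eq_stdGaussian, Measure.map_map (by fun_prop) (by fun_prop)]
    exact Measure.map_id.symm
  have : IsGaussian (gaussianNoise n) := by rw [hmap]; infer_instance
  refine IsGaussian.map_rotation_eq_self ?_ θ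
  ext p
  have h1 : Integrable (id : Tensor3 n → Tensor3 n) (gaussianNoise n) := IsGaussian.integrable_id
  have h2 := eval_integral (μ := gaussianNoise n) (f := (id : Tensor3 n → Tensor3 n))
    (fun i => h1.eval i) p
  rw [h2]
  have h3 := integral_comp_eval (μ := fun _ : Fin n × Fin n × Fin n => gaussianReal 0 1)
      (i := p) (f := fun x : ℝ => x) (by fun_prop)
  simp only [id]
  rw [gaussianNoise, h3, integral_id_gaussianReal]
  rfl

theorem crossForm_smul_smul (c : ℝ) (G H : Tensor3 n) (X Y : Fin n × Fin n → ℝ) :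
    crossForm (c • G) (c • H) X Y = c ^ 2 * crossForm G H X Y := by
  simp only [crossForm, slicesMul, Pi.smul_apply, smul_eq_mul, Finset.mul_sum]
  congr! 2
  ring

/-- Decoupling: for all but an exponentially small fraction of the tensors `A`, every event of
probability at most `1 / 4` is avoided by some `A'` for which the cross form of `A - A'` and
`A + A'` is small. -/
theorem exists_decoupled_partner (hn : 1 ≤ n) :
    ∃ S : Set (Tensor3 n), gaussianNoise n S ≤ ENNReal.ofReal (8 * Real.exp (-(2 * n))) ∧
      ∀ A ∉ S, ∀ B : Set (Tensor3 n), (gaussianNoise n).real B ≤ 1 / 4 →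
        ∃ A' ∉ B, ∀ X Y, |crossForm (A - A') (A + A') X Y| ≤ 1024 * (n * √n) * l2 X * l2 Y := by
  obtain ⟨E, hEm, hE, hEn⟩ := crossForm_tail hn
  set R := ContinuousLinearMap.rotation (E := Tensor3 n) (-(Real.pi / 4)) with hR
  have hRm : Measurable R := R.continuous.measurable
  set E' := R ⁻¹' E
  have hE'm : MeasurableSet E' := hRm hEm
  have hE' : (gaussianNoise n).prod (gaussianNoise n) E' ≤
      ENNReal.ofReal (4 * Real.exp (-(2 * n))) := by
    rw [← Measure.map_apply hRm hEm, map_rotation_gaussianNoise]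
    exact hE
  -- The bad `A` are those for which at least half of the partners fail; Markov's inequality doubles
  -- the bound `4 exp (-2n)`.
  refine ⟨{A | (2 : ENNReal)⁻¹ ≤ gaussianNoise n (Prod.mk A ⁻¹' E')}, ?_, ?_⟩
  · have h1 := mul_meas_ge_le_lintegral (μ := gaussianNoise n)
      (measurable_measure_prodMk_left (ν := gaussianNoise n) hE'm) (2 : ENNReal)⁻¹
    rw [← Measure.prod_apply hE'm] at h1
    have h2 := h1.trans hE'
    rw [ENNReal.inv_mul_le_iff (by simp) (by simp)] at h2
    refine h2.trans_eq ?_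
    rw [show (2 : ENNReal) = ENNReal.ofReal 2 by simp, ← ENNReal.ofReal_mul (by norm_num)]
    ring_nf
  · intro A hA B hB
    by_contra! hcon
    -- Without a good partner these two sets would cover the space, although their masses are at
    -- most `1/4` and below `1/2`.
    have hcover : (Set.univ : Set (Tensor3 n)) ⊆ B ∪ Prod.mk A ⁻¹' E' := by
      intro A' _
      by_contra hA'
      rw [Set.mem_union, not_or] at hA'
      obtain ⟨X, Y, hXY⟩ := hcon A' hA'.1
      have hs : R (A, A') = ((√2 / 2) • (A - A'), (√2 / 2) • (A + A')) := by
        rw [hR, ContinuousLinearMap.rotation_apply]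
        simp only [Real.cos_neg, Real.sin_neg, Real.cos_pi_div_four, Real.sin_pi_div_four]
        ext i <;> simp <;> ring
      have h1 : ((√2 / 2) • (A - A'), (√2 / 2) • (A + A')) ∉ E := by
        rw [← hs]; exact hA'.2
      have h2 := hEn _ _ h1 X Y
      rw [crossForm_smul_smul, div_pow, Real.sq_sqrt (by norm_num), abs_mul] at h2
      norm_num at h2
      linarith
    have h3 : (gaussianNoise n).real (Prod.mk A ⁻¹' E') < 1 / 2 := by
      have h4 : gaussianNoise n (Prod.mk A ⁻¹' E') < 2⁻¹ := not_le.1 hA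
      rw [measureReal_def]
      have := ENNReal.toReal_strict_mono (by simp) h4
      simpa using this
    have h5 := (measureReal_mono (μ := gaussianNoise n) hcover).trans (measureReal_union_le _ _)
    rw [probReal_univ] at h5
    linarith

end Decoupling
-- Pseudo-expectations on the sphere.
section PseudoExpectation

variable {n : ℕ}

/-- A linear functional on all polynomials that restricts to a degree-`4` pseudo-expectation
satisfying the unit sphere constraint. -/
structure IsSphereFunctional (L : MvPolynomial (Fin n) ℝ →ₗ[ℝ] ℝ) : Prop where
  map_one : L 1 = 1
  map_sq_nonneg : ∀ p : MvPolynomial (Fin n) ℝ, p.totalDegree ≤ 2 → 0 ≤ L (p ^ 2)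
  map_sphere : ∀ q : MvPolynomial (Fin n) ℝ, q.totalDegree ≤ 2 →
    L ((∑ i, X i ^ 2) * q) = L q

theorem totalDegree_spherePoly_le (n : ℕ) : (spherePoly n).totalDegree ≤ 2 := by
  unfold spherePoly
  refine (totalDegree_sub _ _).trans (max_le ?_ (by simp))
  refine totalDegree_finsetSum_le fun i _ => ?_
  simp

/-- An arbitrary linear extension removes the degree certificates from the argument of `L`; its
values above degree `4` carry no information. -/
theorem IsFeasible.exists_sphereFunctional {L : PolyLE n 4 →ₗ[ℝ] ℝ} (hL : IsFeasible L) :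
    ∃ L' : MvPolynomial (Fin n) ℝ →ₗ[ℝ] ℝ, IsSphereFunctional L' ∧ ∀ p h, L ⟨p, h⟩ = L' p := by
  obtain ⟨L', hL'⟩ := L.exists_extend
  have hLL : ∀ p h, L ⟨p, h⟩ = L' p := fun p h => by rw [← hL']; rfl
  refine ⟨L', ⟨?_, fun p hp => ?_, fun q hq => ?_⟩, hLL⟩
  · rw [← hLL _ (one_mem_polyLE n 4)]; exact hL.1.map_one
  · have hp' : p ∈ PolyLE n (4 / 2) := by rwa [mem_restrictTotalDegree]
    rw [← hLL _ (sq_mem_polyLE hp')]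
    exact hL.1.map_sq_nonneg p hp'
  · have hmem : spherePoly n * q ∈ PolyLE n 4 := by
      rw [mem_restrictTotalDegree]
      have := totalDegree_mul (spherePoly n) q
      have := totalDegree_spherePoly_le n
      omega
    have h1 := hL.2 q hmem
    rw [hLL, spherePoly, sub_mul, one_mul, map_sub] at h1
    linarith

theorem evalAt_isFeasible {v : Fin n → ℝ} (hv : ∑ i, v i ^ 2 = 1) :
    IsFeasible ((aeval v).toLinearMap ∘ₗ (PolyLE n 4).subtype : PolyLE n 4 →ₗ[ℝ] ℝ) := by
  refine ⟨⟨by simp, fun p hp => ?_⟩, fun q h => ?_⟩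
  · simp only [LinearMap.comp_apply, Submodule.subtype_apply, AlgHom.toLinearMap_apply, map_pow]
    positivity
  · simp [spherePoly, hv]

/-- Transfers an inequality between real quadratic forms to pseudo-expectations: the moment matrix
`L (p_r p_s)` is positive semidefinite, hence a sum of rank-one matrices `v vᵀ`, and the hypothesis
applies to each `v`. -/
theorem IsSphereFunctional.quadratic_form_le {L : MvPolynomial (Fin n) ℝ →ₗ[ℝ] ℝ}
    (hL : IsSphereFunctional L) {ι : Type*} [Fintype ι] (p : ι → MvPolynomial (Fin n) ℝ)
    (hp : ∀ r, (p r).totalDegree ≤ 2) (N : ι → ι → ℝ) (c : ℝ)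
    (hN : ∀ w : ι → ℝ, ∑ r, ∑ s, N r s * (w r * w s) ≤ c * ∑ r, w r ^ 2) :
    ∑ r, ∑ s, N r s * L (p r * p s) ≤ c * ∑ r, L (p r ^ 2) := by
  classical
  let M : Matrix ι ι ℝ := Matrix.of fun r s => L (p r * p s)
  have hM : M.PosSemidef := by
    refine Matrix.PosSemidef.of_dotProduct_mulVec_nonneg ?_ fun x => ?_
    · ext r s
      simp [M, mul_comm]
    · have h1 : star x ⬝ᵥ M.mulVec x = L ((∑ r, C (x r) * p r) ^ 2) := by
        rw [sq, Finset.sum_mul_sum, map_sum]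
        simp only [dotProduct, Matrix.mulVec, M, Matrix.of_apply, map_sum, Finset.mul_sum,
          Pi.star_apply, star_trivial]
        refine Finset.sum_congr rfl fun r _ => Finset.sum_congr rfl fun s _ => ?_
        rw [show C (x r) * p r * (C (x s) * p s) = (x r * x s) • (p r * p s) by
          rw [smul_eq_C_mul, C_mul]; ring, map_smul, smul_eq_mul]
        ring
      rw [h1]
      refine hL.map_sq_nonneg _ (totalDegree_finsetSum_le fun r _ => ?_)
      rw [← smul_eq_C_mul]
      exact (totalDegree_smul_le _ _).trans (hp r)
  obtain ⟨m, v, hv⟩ := Matrix.posSemidef_iff_eq_sum_vecMulVec.1 hM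
  have hMe : ∀ r s, L (p r * p s) = ∑ a, v a r * v a s := fun r s => by
    have := congrFun (congrFun hv r) s
    simpa [M, Matrix.sum_apply, Matrix.vecMulVec_apply] using this
  calc ∑ r, ∑ s, N r s * L (p r * p s)
      = ∑ a, ∑ r, ∑ s, N r s * (v a r * v a s) := by
        simp_rw [hMe, Finset.mul_sum]
        exact (Finset.sum_congr rfl fun r _ => Finset.sum_comm).trans Finset.sum_comm
    _ ≤ ∑ a, c * ∑ r, v a r ^ 2 := Finset.sum_le_sum fun a _ => hN (v a)
    _ = c * ∑ r, L (p r ^ 2) := by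
        simp_rw [sq, hMe]
        rw [← Finset.mul_sum, Finset.sum_comm]

end PseudoExpectation
-- The uniform bound on the noise energy.
section Energy

variable {n : ℕ} {L : MvPolynomial (Fin n) ℝ →ₗ[ℝ] ℝ}

/-- The quadratic form of the `k`-th slice of a tensor. -/
noncomputable def slicePoly (A : Tensor3 n) (k : Fin n) : MvPolynomial (Fin n) ℝ :=
  ∑ r : Fin n × Fin n, A (r.1, r.2, k) • (X r.1 * X r.2)

/-- The pseudo-expectation of `‖Aᵀ (x ⊗ x)‖²`. -/
noncomputable def energy (L : MvPolynomial (Fin n) ℝ →ₗ[ℝ] ℝ) (A : Tensor3 n) : ℝ :=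
  ∑ k, L (slicePoly A k ^ 2)

theorem totalDegree_X_mul_X_le (i j : Fin n) :
    (X i * X j : MvPolynomial (Fin n) ℝ).totalDegree ≤ 2 :=
  (totalDegree_mul _ _).trans (by simp)

theorem totalDegree_slicePoly_le (A : Tensor3 n) (k : Fin n) :
    (slicePoly A k).totalDegree ≤ 2 :=
  totalDegree_finsetSum_le fun _ _ =>
    (totalDegree_smul_le _ _).trans (totalDegree_X_mul_X_le _ _)

theorem totalDegree_sum_X_sq_le (n : ℕ) :
    (∑ i, X i ^ 2 : MvPolynomial (Fin n) ℝ).totalDegree ≤ 2 :=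
  totalDegree_finsetSum_le fun i _ => by simp

theorem IsSphereFunctional.sum_sq_monomials (hL : IsSphereFunctional L) :
    ∑ r : Fin n × Fin n, L ((X r.1 * X r.2) ^ 2) = 1 := by
  have h1 := hL.map_sphere _ (totalDegree_sum_X_sq_le n)
  have h2 := hL.map_sphere 1 (by simp)
  rw [mul_one, hL.map_one] at h2
  rw [h2, Finset.sum_mul_sum, map_sum] at h1
  rw [Fintype.sum_prod_type, ← h1]
  refine Finset.sum_congr rfl fun i _ => ?_
  rw [map_sum]
  exact Finset.sum_congr rfl fun j _ => by rw [mul_pow]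

theorem map_slicePoly_mul (L : MvPolynomial (Fin n) ℝ →ₗ[ℝ] ℝ) (A B : Tensor3 n) (k : Fin n) :
    L (slicePoly A k * slicePoly B k) = ∑ q : Fin n × Fin n, ∑ r : Fin n × Fin n,
      A (q.1, q.2, k) * B (r.1, r.2, k) * L (X q.1 * X q.2 * (X r.1 * X r.2)) := by
  simp only [slicePoly, Finset.sum_mul_sum, map_sum, smul_mul_smul_comm, map_smul, smul_eq_mul]

theorem crossForm_eq_sum (G H : Tensor3 n) (X Y : Fin n × Fin n → ℝ) :
    crossForm G H X Y = ∑ r : Fin n × Fin n, ∑ s : Fin n × Fin n,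
      (∑ k, G (r.1, s.1, k) * H (r.2, s.2, k)) * (X r * Y s) := by
  simp only [crossForm, slicesMul, Fintype.sum_prod_type, Finset.mul_sum, Finset.sum_mul]
  refine Finset.sum_congr rfl fun i _ => ?_
  have h1 : ∀ f : Fin n → Fin n → Fin n → Fin n → ℝ,
      ∑ j, ∑ k, ∑ a, ∑ b, f j k a b = ∑ a, ∑ j, ∑ b, ∑ k, f j k a b := fun f => by
    calc ∑ j, ∑ k, ∑ a, ∑ b, f j k a b = ∑ j, ∑ a, ∑ k, ∑ b, f j k a b :=
          Finset.sum_congr rfl fun j _ => Finset.sum_comm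
      _ = ∑ a, ∑ j, ∑ k, ∑ b, f j k a b := Finset.sum_comm
      _ = _ := Finset.sum_congr rfl fun a _ => Finset.sum_congr rfl fun j _ => Finset.sum_comm
  rw [h1]
  refine Finset.sum_congr rfl fun a _ => Finset.sum_congr rfl fun j _ =>
    Finset.sum_congr rfl fun b _ => Finset.sum_congr rfl fun k _ => by ring

/-- The term `G_{ijk} H_{abk} L(x_i x_j x_a x_b)` is regrouped with row index `(i, a)` and column
index `(j, b)`, which commutativity permits. The coefficient matrix becomes `∑ G_k ⊗ H_k`, and the
monomials `x_i x_a` have total pseudo-square `1`. -/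
theorem IsSphereFunctional.sum_slicePoly_mul_le (hL : IsSphereFunctional L) (G H : Tensor3 n)
    {N : ℝ} (hN : ∀ X Y, |crossForm G H X Y| ≤ N * l2 X * l2 Y) :
    ∑ k, L (slicePoly G k * slicePoly H k) ≤ N := by
  have h1 := hL.quadratic_form_le (fun r : Fin n × Fin n => X r.1 * X r.2)
    (fun r => totalDegree_X_mul_X_le _ _)
    (fun r s => ∑ k, G (r.1, s.1, k) * H (r.2, s.2, k)) N (fun w => by
      rw [← crossForm_eq_sum, ← sq_l2, sq, ← mul_assoc]
      exact (le_abs_self _).trans (hN w w))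
  rw [hL.sum_sq_monomials, mul_one] at h1
  refine le_trans (le_of_eq ?_) h1
  simp only [map_slicePoly_mul, Fintype.sum_prod_type, Finset.sum_mul]
  have h2 : ∀ f : Fin n → Fin n → Fin n → Fin n → Fin n → ℝ,
      ∑ k, ∑ i, ∑ j, ∑ a, ∑ b, f k i j a b = ∑ i, ∑ a, ∑ j, ∑ b, ∑ k, f k i j a b := fun f => by
    rw [Finset.sum_comm]
    refine Finset.sum_congr rfl fun i _ => ?_
    calc ∑ k, ∑ j, ∑ a, ∑ b, f k i j a b = ∑ k, ∑ a, ∑ j, ∑ b, f k i j a b :=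
          Finset.sum_congr rfl fun j _ => Finset.sum_comm
      _ = ∑ a, ∑ k, ∑ j, ∑ b, f k i j a b := Finset.sum_comm
      _ = ∑ a, ∑ j, ∑ k, ∑ b, f k i j a b := Finset.sum_congr rfl fun j _ => Finset.sum_comm
      _ = _ := Finset.sum_congr rfl fun a _ => Finset.sum_congr rfl fun j _ => Finset.sum_comm
  rw [h2]
  refine Finset.sum_congr rfl fun i _ => Finset.sum_congr rfl fun a _ =>
    Finset.sum_congr rfl fun j _ => Finset.sum_congr rfl fun b _ =>
    Finset.sum_congr rfl fun k _ => ?_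
  rw [mul_mul_mul_comm (X i)]

theorem slicePoly_sub (A B : Tensor3 n) (k : Fin n) :
    slicePoly (A - B) k = slicePoly A k - slicePoly B k := by
  simp only [slicePoly, Pi.sub_apply, sub_smul, Finset.sum_sub_distrib]

theorem slicePoly_add (A B : Tensor3 n) (k : Fin n) :
    slicePoly (A + B) k = slicePoly A k + slicePoly B k := by
  simp only [slicePoly, Pi.add_apply, add_smul, Finset.sum_add_distrib]

theorem energy_nonneg (hL : IsSphereFunctional L) (A : Tensor3 n) : 0 ≤ energy L A :=
  Finset.sum_nonneg fun k _ => hL.map_sq_nonneg _ (totalDegree_slicePoly_le A k)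

theorem energy_sub_energy (L : MvPolynomial (Fin n) ℝ →ₗ[ℝ] ℝ) (A B : Tensor3 n) :
    energy L A - energy L B = ∑ k, L (slicePoly (A - B) k * slicePoly (A + B) k) := by
  rw [energy, energy, ← Finset.sum_sub_distrib]
  refine Finset.sum_congr rfl fun k _ => ?_
  rw [← map_sub, slicePoly_sub, slicePoly_add]
  congr 1
  ring

theorem integrable_energy (L : MvPolynomial (Fin n) ℝ →ₗ[ℝ] ℝ) :
    Integrable (energy L) (gaussianNoise n) := by
  have : energy L = fun A => ∑ k, ∑ q : Fin n × Fin n, ∑ r : Fin n × Fin n,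
      A (q.1, q.2, k) * A (r.1, r.2, k) * L (X q.1 * X q.2 * (X r.1 * X r.2)) := by
    ext A
    simp only [energy, sq, map_slicePoly_mul]
  rw [this]
  exact integrable_finsetSum _ fun k _ => integrable_finsetSum _ fun q _ =>
    integrable_finsetSum _ fun r _ => (integrable_mul_gaussianNoise _ _).1.mul_const _

/-- The entries of `A` are orthonormal, so only diagonal terms survive and each slice contributes `L
‖x‖⁴ = 1`. -/
theorem integral_energy (hL : IsSphereFunctional L) :
    ∫ A, energy L A ∂gaussianNoise n = n := by
  simp only [energy, sq, map_slicePoly_mul]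
  have hint : ∀ (k : Fin n) (q r : Fin n × Fin n), Integrable (fun A : Tensor3 n =>
      A (q.1, q.2, k) * A (r.1, r.2, k) * L (X q.1 * X q.2 * (X r.1 * X r.2)))
      (gaussianNoise n) := fun k q r => (integrable_mul_gaussianNoise _ _).1.mul_const _
  rw [integral_finsetSum _ fun k _ => integrable_finsetSum _ fun q _ =>
    integrable_finsetSum _ fun r _ => hint k q r]
  have hk : ∀ k : Fin n, ∫ A : Tensor3 n, ∑ q : Fin n × Fin n, ∑ r : Fin n × Fin n,
      A (q.1, q.2, k) * A (r.1, r.2, k) * L (X q.1 * X q.2 * (X r.1 * X r.2))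
        ∂gaussianNoise n = 1 := fun k => by
    rw [integral_finsetSum _ fun q _ => integrable_finsetSum _ fun r _ => hint k q r,
      ← hL.sum_sq_monomials]
    refine Finset.sum_congr rfl fun q _ => ?_
    rw [integral_finsetSum _ fun r _ => hint k q r, Finset.sum_eq_single q]
    · rw [integral_mul_const, (integrable_mul_gaussianNoise _ _).2, if_pos rfl, one_mul, sq]
    · intro r _ hr
      rw [integral_mul_const, (integrable_mul_gaussianNoise _ _).2, if_neg, zero_mul]
      intro h
      simp only [Prod.mk.injEq] at h
      exact hr (Prod.ext h.1.symm h.2.1.symm)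
    · simp
  simp [hk]

/-- With overwhelming probability, the polynomial `‖Aᵀ (x ⊗ x)‖²` has pseudo-expectation
`O(n ^ (3 / 2))`, uniformly over all degree-`4` pseudo-expectations on the sphere. -/
theorem energy_tail (hn : 1 ≤ n) :
    ∃ S : Set (Tensor3 n), gaussianNoise n S ≤ ENNReal.ofReal (8 * Real.exp (-(2 * n))) ∧
      ∀ A ∉ S, ∀ L : MvPolynomial (Fin n) ℝ →ₗ[ℝ] ℝ, IsSphereFunctional L →
        energy L A ≤ 1028 * (n * √n) := by
  obtain ⟨S, hS, hSn⟩ := exists_decoupled_partner hn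
  refine ⟨S, hS, fun A hA L hL => ?_⟩
  have hn1 : (1 : ℝ) ≤ n := by exact_mod_cast hn
  -- This event depends on `L`, while `S` was fixed beforehand; that order gives uniformity in `L`.
  have hB : (gaussianNoise n).real {A' | 4 * (n : ℝ) ≤ energy L A'} ≤ 1 / 4 := by
    have h1 := mul_meas_ge_le_integral_of_nonneg (μ := gaussianNoise n)
      (Filter.Eventually.of_forall (energy_nonneg hL)) (integrable_energy L) (4 * (n : ℝ))
    rw [integral_energy hL] at h1
    nlinarith
  obtain ⟨A', hA', hcross⟩ := hSn A hA _ hB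
  have h1 := hL.sum_slicePoly_mul_le _ _ hcross
  rw [← energy_sub_energy] at h1
  have h2 : energy L A' < 4 * n := not_le.1 hA'
  have h3 : 1 ≤ √(n : ℝ) := Real.one_le_sqrt.2 hn1
  nlinarith

end Energy
-- Compactness of the feasible set and existence of a maximizer.
section Existence

variable {n : ℕ} {L : MvPolynomial (Fin n) ℝ →ₗ[ℝ] ℝ}

theorem IsSphereFunctional.abs_map_mul_le (hL : IsSphereFunctional L)
    {p q : MvPolynomial (Fin n) ℝ} (hp : p.totalDegree ≤ 2) (hq : q.totalDegree ≤ 2) :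
    |L (p * q)| ≤ (L (p ^ 2) + L (q ^ 2)) / 2 := by
  have h1 := hL.map_sq_nonneg (p + q) ((totalDegree_add _ _).trans (max_le hp hq))
  have h2 := hL.map_sq_nonneg (p - q) ((totalDegree_sub _ _).trans (max_le hp hq))
  rw [show (p + q) ^ 2 = p ^ 2 + q ^ 2 + (2 : ℝ) • (p * q) by rw [two_smul]; ring, map_add, map_add,
    map_smul, smul_eq_mul] at h1
  rw [show (p - q) ^ 2 = p ^ 2 + q ^ 2 - (2 : ℝ) • (p * q) by rw [two_smul]; ring, map_sub, map_add,
    map_smul, smul_eq_mul] at h2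
  rw [abs_le]
  constructor <;> linarith

/-- The monomials of degree at most one. -/
noncomputable def affineMonomial (o : Option (Fin n)) : MvPolynomial (Fin n) ℝ := o.elim 1 X

theorem totalDegree_affineMonomial_mul_le (a b : Option (Fin n)) :
    (affineMonomial a * affineMonomial b).totalDegree ≤ 2 := by
  have h : ∀ o : Option (Fin n), (affineMonomial o).totalDegree ≤ 1 := fun o => by
    cases o <;> simp [affineMonomial]
  have := totalDegree_mul (affineMonomial a) (affineMonomial b)
  have := h a
  have := h b
  omega

theorem IsSphereFunctional.sum_map_sq_X (hL : IsSphereFunctional L) :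
    ∑ i, L (X i ^ 2) = 1 := by
  have h1 := hL.map_sphere 1 (by simp)
  rwa [mul_one, hL.map_one, map_sum] at h1

theorem IsSphereFunctional.map_sq_X_le (hL : IsSphereFunctional L) (i : Fin n) :
    L (X i ^ 2) ≤ 1 := by
  rw [← hL.sum_map_sq_X]
  exact Finset.single_le_sum (f := fun i => L (X i ^ 2))
    (fun j _ => hL.map_sq_nonneg _ (by simp)) (Finset.mem_univ i)

theorem IsSphereFunctional.map_sq_affineMonomial_mul_le (hL : IsSphereFunctional L)
    (a b : Option (Fin n)) : L ((affineMonomial a * affineMonomial b) ^ 2) ≤ 1 := by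
  rcases a with _ | i <;> rcases b with _ | j
  · simp [affineMonomial, hL.map_one]
  · simpa [affineMonomial] using hL.map_sq_X_le j
  · simpa [affineMonomial] using hL.map_sq_X_le i
  · have h0 : ∀ r : Fin n × Fin n, 0 ≤ L ((X r.1 * X r.2) ^ 2) := fun r =>
      hL.map_sq_nonneg _ (totalDegree_X_mul_X_le r.1 r.2)
    have h1 := Finset.single_le_sum (s := Finset.univ) (fun r _ => h0 r) (Finset.mem_univ (i, j))
    exact h1.trans_eq hL.sum_sq_monomials

theorem exists_monomial_eq_affineMonomial_mul (k : ℕ) (s : Fin n →₀ ℕ) (hs : s.degree ≤ k + 1) :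
    ∃ (o : Option (Fin n)) (s' : Fin n →₀ ℕ), s'.degree ≤ k ∧
      (monomial s 1 : MvPolynomial (Fin n) ℝ) = affineMonomial o * monomial s' 1 := by
  by_cases h0 : s = 0
  · exact ⟨none, 0, by simp, by simp [h0, affineMonomial]⟩
  · obtain ⟨i, hi⟩ := Finsupp.ne_iff.1 h0
    have hi' : 1 ≤ s i := Nat.one_le_iff_ne_zero.2 hi
    have hle : Finsupp.single i 1 ≤ s := Finsupp.single_le_iff.2 hi'
    have hs' : Finsupp.single i 1 + (s - Finsupp.single i 1) = s := add_tsub_cancel_of_le hle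
    refine ⟨some i, s - Finsupp.single i 1, ?_, ?_⟩
    · have := congrArg Finsupp.degree hs'
      rw [map_add, Finsupp.degree_single] at this
      omega
    · simp only [affineMonomial, Option.elim_some, X, monomial_mul, hs', mul_one]

/-- A monomial of degree at most `4` is a product of two of degree at most `2`, whose squares have
pseudo-expectation at most `1`. -/
theorem IsSphereFunctional.abs_map_monomial_le (hL : IsSphereFunctional L) (s : Fin n →₀ ℕ)
    (hs : s.degree ≤ 4) : |L (monomial s 1)| ≤ 1 := by
  obtain ⟨a, s1, h1, e1⟩ := exists_monomial_eq_affineMonomial_mul 3 s hs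
  obtain ⟨b, s2, h2, e2⟩ := exists_monomial_eq_affineMonomial_mul 2 s1 h1
  obtain ⟨c, s3, h3, e3⟩ := exists_monomial_eq_affineMonomial_mul 1 s2 h2
  obtain ⟨d, s4, h4, e4⟩ := exists_monomial_eq_affineMonomial_mul 0 s3 h3
  have h5 : s4 = 0 := by
    rw [← Finsupp.degree_eq_zero_iff]
    omega
  have e : (monomial s 1 : MvPolynomial (Fin n) ℝ) =
      (affineMonomial a * affineMonomial b) * (affineMonomial c * affineMonomial d) := by
    rw [e1, e2, e3, e4, h5, monomial_zero', C_1]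
    ring
  rw [e]
  have h6 := hL.abs_map_mul_le (totalDegree_affineMonomial_mul_le a b)
    (totalDegree_affineMonomial_mul_le c d)
  have h7 := hL.map_sq_affineMonomial_mul_le a b
  have h8 := hL.map_sq_affineMonomial_mul_le c d
  linarith

theorem exists_abs_map_le (p : MvPolynomial (Fin n) ℝ) (hp : p.totalDegree ≤ 4) :
    ∃ c : ℝ, ∀ L : MvPolynomial (Fin n) ℝ →ₗ[ℝ] ℝ, IsSphereFunctional L → |L p| ≤ c := by
  refine ⟨∑ s ∈ p.support, |coeff s p|, fun L hL => ?_⟩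
  conv_lhs => rw [p.as_sum, map_sum]
  refine (Finset.abs_sum_le_sum_abs _ _).trans (Finset.sum_le_sum fun s hs => ?_)
  have h1 : s.degree ≤ 4 := (le_totalDegree hs).trans hp
  have h2 : monomial s (coeff s p) = coeff s p • (monomial s 1 : MvPolynomial (Fin n) ℝ) := by
    rw [smul_monomial, smul_eq_mul, mul_one]
  rw [h2, map_smul, smul_eq_mul, abs_mul]
  exact mul_le_of_le_one_right (abs_nonneg _) (hL.abs_map_monomial_le s h1)

theorem isClosed_forall {α : Type*} [TopologicalSpace α] {ι : Sort*} {P : ι → α → Prop}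
    (h : ∀ i, IsClosed {a | P i a}) : IsClosed {a | ∀ i, P i a} := by
  rw [Set.ofPred_forall]
  exact isClosed_iInter h

/-- Tychonoff: each coordinate is bounded, and linearity, normalization, positivity and the sphere
constraint are closed conditions for pointwise convergence. -/
theorem isCompact_feasible (n : ℕ) :
    IsCompact {f : PolyLE n 4 → ℝ | ∃ L : PolyLE n 4 →ₗ[ℝ] ℝ, IsFeasible L ∧ ⇑L = f} := by
  have hb : ∀ p : PolyLE n 4, ∃ c : ℝ, ∀ L : PolyLE n 4 →ₗ[ℝ] ℝ, IsFeasible L → |L p| ≤ c := by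
    intro p
    obtain ⟨c, hc⟩ := exists_abs_map_le p.1 ((mem_restrictTotalDegree _ _ _).1 p.2)
    refine ⟨c, fun L hL => ?_⟩
    obtain ⟨L', hL', hLL⟩ := hL.exists_sphereFunctional
    have := hc L' hL'
    rwa [← hLL p.1 p.2] at this
  choose c hc using hb
  refine (isCompact_univ_pi fun p => isCompact_Icc (a := -c p) (b := c p)).of_isClosed_subset ?_ ?_
  · have e : {f : PolyLE n 4 → ℝ | ∃ L : PolyLE n 4 →ₗ[ℝ] ℝ, IsFeasible L ∧ ⇑L = f} =
        {f | (∀ p q, f (p + q) = f p + f q) ∧ (∀ (a : ℝ) p, f (a • p) = a * f p) ∧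
          f ⟨1, one_mem_polyLE n 4⟩ = 1 ∧
          (∀ (p : MvPolynomial (Fin n) ℝ) (hp : p ∈ PolyLE n (4 / 2)),
            0 ≤ f ⟨p ^ 2, sq_mem_polyLE hp⟩) ∧
          ∀ (q : MvPolynomial (Fin n) ℝ) (h : spherePoly n * q ∈ PolyLE n 4),
            f ⟨spherePoly n * q, h⟩ = 0} := by
      ext f
      constructor
      · rintro ⟨L, hL, rfl⟩
        exact ⟨map_add L, map_smul L, hL.1.map_one, hL.1.map_sq_nonneg, hL.2⟩
      · rintro ⟨h1, h2, h3, h4, h5⟩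
        exact ⟨{ toFun := f, map_add' := h1, map_smul' := h2 }, ⟨⟨h3, h4⟩, h5⟩, rfl⟩
    rw [e]
    refine IsClosed.and ?_ (IsClosed.and ?_ (IsClosed.and ?_ (IsClosed.and ?_ ?_)))
    · exact isClosed_forall fun p => isClosed_forall fun q =>
        isClosed_eq (continuous_apply _) ((continuous_apply p).add (continuous_apply q))
    · exact isClosed_forall fun a => isClosed_forall fun p =>
        isClosed_eq (continuous_apply _) (continuous_const.mul (continuous_apply p))
    · exact isClosed_eq (continuous_apply _) continuous_const
    · exact isClosed_forall fun p => isClosed_forall fun hp =>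
        isClosed_le continuous_const (continuous_apply _)
    · exact isClosed_forall fun q => isClosed_forall fun h =>
        isClosed_eq (continuous_apply _) continuous_const
  · rintro f ⟨L, hL, rfl⟩
    simp only [Set.mem_pi, Set.mem_univ, forall_const, Set.mem_Icc]
    exact fun p => abs_le.1 (hc p L hL)

theorem exists_isMaximizer (T : Tensor3 n) {L₀ : PolyLE n 4 →ₗ[ℝ] ℝ} (h₀ : IsFeasible L₀) :
    ∃ L : PolyLE n 4 →ₗ[ℝ] ℝ, IsMaximizer T L := by
  obtain ⟨f, ⟨L, hL, rfl⟩, hmax⟩ := (isCompact_feasible n).exists_isMaxOn ⟨_, L₀, h₀, rfl⟩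
    (continuous_apply (⟨tensorPoly T, tensorPoly_mem T⟩ : PolyLE n 4)).continuousOn
  exact ⟨L, hL, fun L' hL' => hmax ⟨L', hL', rfl⟩⟩

end Existence
-- Signal and noise parts of the objective.
section Signal

variable {n : ℕ} {L : MvPolynomial (Fin n) ℝ →ₗ[ℝ] ℝ}

/-- The linear form with coefficient vector `w`. -/
noncomputable def linPoly (w : Fin n → ℝ) : MvPolynomial (Fin n) ℝ := ∑ i, w i • X i

theorem totalDegree_linPoly_le (w : Fin n → ℝ) : (linPoly w).totalDegree ≤ 1 :=
  totalDegree_finsetSum_le fun i _ => (totalDegree_smul_le _ _).trans (by simp)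

/-- The coordinates of the component of `x` orthogonal to `v`. -/
noncomputable def residual (v : Fin n → ℝ) (i : Fin n) : MvPolynomial (Fin n) ℝ := X i - v i • linPoly v

theorem totalDegree_residual_le (v : Fin n → ℝ) (i : Fin n) : (residual v i).totalDegree ≤ 1 :=
  (totalDegree_sub _ _).trans
    (max_le (by simp) ((totalDegree_smul_le _ _).trans (totalDegree_linPoly_le v)))

theorem sum_sq_residual {v : Fin n → ℝ} (hv : ∑ i, v i ^ 2 = 1) :
    ∑ i, residual v i ^ 2 = (∑ i, X i ^ 2) - linPoly v ^ 2 := by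
  have h1 : ∀ i, residual v i ^ 2 =
      X i ^ 2 - (2 : ℝ) • (v i • X i * linPoly v) + (v i ^ 2) • linPoly v ^ 2 := fun i => by
    simp only [residual, smul_eq_C_mul, map_pow, map_ofNat]
    ring
  simp_rw [h1, Finset.sum_add_distrib, Finset.sum_sub_distrib, ← Finset.smul_sum,
    ← Finset.sum_mul, ← Finset.sum_smul, hv, one_smul]
  rw [show ∑ i, v i • X i = linPoly v from rfl, two_smul]
  ring

theorem IsSphereFunctional.sum_map_sq_residual (hL : IsSphereFunctional L) {v : Fin n → ℝ}
    (hv : ∑ i, v i ^ 2 = 1) : ∑ i, L (residual v i ^ 2) = 1 - L (linPoly v ^ 2) := by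
  have h1 := hL.map_sphere 1 (by simp)
  rw [mul_one, hL.map_one] at h1
  rw [← map_sum, sum_sq_residual hv, map_sub, h1]

theorem totalDegree_mul_le_two {p q : MvPolynomial (Fin n) ℝ} (hp : p.totalDegree ≤ 1)
    (hq : q.totalDegree ≤ 1) : (p * q).totalDegree ≤ 2 :=
  (totalDegree_mul _ _).trans (add_le_add hp hq)

/-- On the sphere `1 - t²` is the sum of squares of the residual coordinates, and multiplying it by
`q²` keeps it one. -/
theorem IsSphereFunctional.map_sq_linPoly_mul_le (hL : IsSphereFunctional L) {v : Fin n → ℝ}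
    (hv : ∑ i, v i ^ 2 = 1) {q : MvPolynomial (Fin n) ℝ} (hq : q.totalDegree ≤ 1) :
    L (linPoly v ^ 2 * q ^ 2) ≤ L (q ^ 2) := by
  have h1 := hL.map_sphere (q ^ 2) (by rw [sq]; exact totalDegree_mul_le_two hq hq)
  have h2 : 0 ≤ L ((∑ i, residual v i ^ 2) * q ^ 2) := by
    rw [Finset.sum_mul, map_sum]
    refine Finset.sum_nonneg fun i _ => ?_
    rw [← mul_pow]
    exact hL.map_sq_nonneg _ (totalDegree_mul_le_two (totalDegree_residual_le v i) hq)
  rw [sum_sq_residual hv, sub_mul, map_sub, h1] at h2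
  linarith

theorem IsSphereFunctional.map_sq_linPoly_le_one (hL : IsSphereFunctional L) {v : Fin n → ℝ}
    (hv : ∑ i, v i ^ 2 = 1) : L (linPoly v ^ 2) ≤ 1 := by
  simpa [hL.map_one] using hL.map_sq_linPoly_mul_le hv (q := 1) (by simp)

theorem totalDegree_one_sub_linPoly_le (v : Fin n → ℝ) : (1 - linPoly v).totalDegree ≤ 1 :=
  (totalDegree_sub _ _).trans (max_le (by simp) (totalDegree_linPoly_le v))

theorem IsSphereFunctional.one_sub_map_sq_linPoly_le (hL : IsSphereFunctional L)
    (v : Fin n → ℝ) : 1 - L (linPoly v ^ 2) ≤ 2 * (1 - L (linPoly v)) := by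
  have h1 := hL.map_sq_nonneg (1 - linPoly v)
    ((totalDegree_one_sub_linPoly_le v).trans one_le_two)
  rw [show (1 - linPoly v) ^ 2 = 1 - (2 : ℝ) • linPoly v + linPoly v ^ 2 by rw [two_smul]; ring,
    map_add, map_sub, hL.map_one, map_smul, smul_eq_mul] at h1
  linarith

/-- The certificate is `2 (1 + 3t - 4t³) = (1 - t)² (2t + 1)² + (1 - t²) (2t + 1)²`. -/
theorem IsSphereFunctional.map_cube_linPoly_le (hL : IsSphereFunctional L) {v : Fin n → ℝ}
    (hv : ∑ i, v i ^ 2 = 1) : L (linPoly v ^ 3) ≤ 1 / 4 + 3 / 4 * L (linPoly v) := by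
  set t := linPoly v with ht
  have hq : ((2 : ℝ) • t + 1).totalDegree ≤ 1 := (totalDegree_add _ _).trans
    (max_le ((totalDegree_smul_le _ _).trans (totalDegree_linPoly_le v)) (by simp))
  have h1 := hL.map_sq_linPoly_mul_le hv hq
  have h2 := hL.map_sq_nonneg ((1 - t) * ((2 : ℝ) • t + 1))
    (totalDegree_mul_le_two (totalDegree_one_sub_linPoly_le v) hq)
  have h3 : ((1 - t) * ((2 : ℝ) • t + 1)) ^ 2 + ((2 : ℝ) • t + 1) ^ 2
      - t ^ 2 * ((2 : ℝ) • t + 1) ^ 2 =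
      (2 : ℝ) • (1 : MvPolynomial (Fin n) ℝ) + (6 : ℝ) • t - (8 : ℝ) • t ^ 3 := by
    simp only [smul_eq_C_mul, map_ofNat]
    ring
  have h4 := congrArg L h3
  simp only [map_add, map_sub, map_smul, smul_eq_mul, hL.map_one] at h4
  linarith

/-- Cauchy–Schwarz against the residual vector. The factor `1 - L t²` is the gain that makes the
effect of `d` second order. -/
theorem IsSphereFunctional.map_sq_sum_residual_le (hL : IsSphereFunctional L) {v : Fin n → ℝ}
    (hv : ∑ i, v i ^ 2 = 1) (d : Fin n → ℝ) :
    L ((∑ i, d i • residual v i) ^ 2) ≤ (∑ i, d i ^ 2) * (1 - L (linPoly v ^ 2)) := by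
  have h1 := hL.quadratic_form_le (residual v)
    (fun i => (totalDegree_residual_le v i).trans one_le_two) (fun r s => d r * d s)
    (∑ i, d i ^ 2) (fun w => by
      refine le_trans (le_of_eq ?_) (Finset.sum_mul_sq_le_sq_mul_sq Finset.univ d w)
      rw [sq, Finset.sum_mul_sum]
      exact Finset.sum_congr rfl fun r _ => Finset.sum_congr rfl fun s _ => by ring)
  rw [hL.sum_map_sq_residual hv] at h1
  refine le_trans (le_of_eq ?_) h1
  simp only [sq, Finset.sum_mul_sum, map_sum, smul_mul_smul_comm, map_smul, smul_eq_mul]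

theorem linPoly_add_eq (v d : Fin n → ℝ) :
    linPoly (v + d) = (1 + ∑ i, d i * v i) • linPoly v + ∑ i, d i • residual v i := by
  have h1 : ∑ i, d i • residual v i = linPoly d - (∑ i, d i * v i) • linPoly v := by
    simp only [residual, smul_sub, Finset.sum_sub_distrib, smul_smul, ← Finset.sum_smul]
    rfl
  rw [h1, add_smul, one_smul]
  simp only [linPoly, Pi.add_apply, add_smul, Finset.sum_add_distrib]
  abel

/-- Upper bound on the pseudo-expectation of `⟨v, x⟩² ⟨v + d, x⟩`, with an error of second order
in `d`. -/
theorem IsSphereFunctional.map_signal_le (hL : IsSphereFunctional L) {v d : Fin n → ℝ}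
    (hv : ∑ i, v i ^ 2 = 1) {δ : ℝ} (hδ : 0 < δ) (hd : ∑ i, d i ^ 2 ≤ δ ^ 2)
    (ha : 0 ≤ 1 + ∑ i, d i * v i) :
    L (linPoly v ^ 2 * linPoly (v + d)) ≤
      (1 + ∑ i, d i * v i) * (1 / 4 + 3 / 4 * L (linPoly v)) +
        1 / 8 * (1 - L (linPoly v)) + 4 * δ ^ 2 := by
  set a := 1 + ∑ i, d i * v i
  set t := linPoly v with ht
  set s := ∑ i, d i • residual v i with hs
  have ht2 := hL.map_sq_linPoly_le_one hv
  have ht4 := hL.map_sq_linPoly_mul_le hv (totalDegree_linPoly_le v)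
  have hs2 := hL.map_sq_sum_residual_le hv d
  have hs1 : s.totalDegree ≤ 1 := totalDegree_finsetSum_le fun i _ =>
    (totalDegree_smul_le _ _).trans (totalDegree_residual_le v i)
  rw [← ht] at ht2 ht4 hs2
  rw [← hs] at hs2
  -- Weighted AM–GM: `t² s ≤ s² / (16 δ²) + 4 δ² t⁴`. The weight turns `L s² ≤ 2 δ² (1 - L t)` into
  -- `(1 - L t) / 8`, small enough to be absorbed later.
  have h1 := hL.map_sq_nonneg ((1 / (4 * δ)) • s - (2 * δ) • t ^ 2) (by
    refine (totalDegree_sub _ _).trans (max_le ?_ ?_)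
    · exact (totalDegree_smul_le _ _).trans (hs1.trans one_le_two)
    · refine (totalDegree_smul_le _ _).trans ?_
      rw [sq]
      exact totalDegree_mul_le_two (totalDegree_linPoly_le v) (totalDegree_linPoly_le v))
  have h2 : ((1 / (4 * δ)) • s - (2 * δ) • t ^ 2) ^ 2 =
      (1 / (4 * δ)) ^ 2 • s ^ 2 - (2 * (1 / (4 * δ)) * (2 * δ)) • (t ^ 2 * s) +
        (2 * δ) ^ 2 • (t ^ 2 * t ^ 2) := by
    simp only [smul_eq_C_mul, map_pow, map_mul, map_ofNat]
    ring
  have h3 : 2 * (1 / (4 * δ)) * (2 * δ) = 1 := by field_simp; norm_num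
  rw [h2, h3, one_smul, map_add, map_sub, map_smul, map_smul, smul_eq_mul, smul_eq_mul] at h1
  have h4 : (1 / (4 * δ)) ^ 2 * L (s ^ 2) ≤ 1 / 16 * (1 - L (t ^ 2)) := by
    calc (1 / (4 * δ)) ^ 2 * L (s ^ 2) ≤ (1 / (4 * δ)) ^ 2 * (δ ^ 2 * (1 - L (t ^ 2))) := by
          gcongr
          exact hs2.trans (mul_le_mul_of_nonneg_right hd (by linarith))
      _ = 1 / 16 * (1 - L (t ^ 2)) := by field_simp; ring
  have h5 : (2 * δ) ^ 2 * L (t ^ 2 * t ^ 2) ≤ 4 * δ ^ 2 := by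
    have : L (t ^ 2 * t ^ 2) ≤ 1 := ht4.trans ht2
    nlinarith [sq_nonneg δ]
  have h6 := hL.one_sub_map_sq_linPoly_le v
  have h7 : L (t ^ 2 * linPoly (v + d)) = a * L (t ^ 3) + L (t ^ 2 * s) := by
    rw [linPoly_add_eq, mul_add, map_add, mul_smul_comm, map_smul, smul_eq_mul, ← pow_succ]
  have h8 := mul_le_mul_of_nonneg_left (hL.map_cube_linPoly_le hv) ha
  rw [h7]
  linarith

theorem IsSphereFunctional.sum_map_sq_linPoly_le (hL : IsSphereFunctional L)
    (Q : Matrix (Fin n) (Fin n) ℝ) {c : ℝ}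
    (hQ : ∀ w : Fin n → ℝ, ∑ l, (∑ r, Q l r * w r) ^ 2 ≤ c * ∑ r, w r ^ 2) :
    ∑ l, L (linPoly (Q l) ^ 2) ≤ c := by
  have h1 := hL.quadratic_form_le (fun i : Fin n => X i) (fun i => by simp)
    (fun r s => ∑ l, Q l r * Q l s) c (fun w => by
      refine le_trans (le_of_eq ?_) (hQ w)
      simp only [sq, Finset.sum_mul_sum]
      simp only [Finset.sum_mul]
      symm
      refine (Finset.sum_comm.trans (Finset.sum_congr rfl fun r _ => Finset.sum_comm)).trans ?_
      exact Finset.sum_congr rfl fun r _ => Finset.sum_congr rfl fun s _ =>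
        Finset.sum_congr rfl fun l _ => by ring)
  rw [hL.sum_map_sq_X, mul_one] at h1
  refine le_trans (le_of_eq ?_) h1
  have h2 : ∀ l, L (linPoly (Q l) ^ 2) = ∑ r, ∑ s, Q l r * Q l s * L (X r * X s) := fun l => by
    simp only [linPoly, sq, Finset.sum_mul_sum, map_sum, smul_mul_smul_comm, map_smul, smul_eq_mul]
  simp only [h2, Finset.sum_mul]
  exact Finset.sum_comm.trans (Finset.sum_congr rfl fun r _ => Finset.sum_comm)

/-- Cauchy–Schwarz, obtained by summing `L ((q A_l + c y_l)²) ≥ 0` over `l` and taking `c = ±B`. -/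
theorem IsSphereFunctional.abs_noise_le (hL : IsSphereFunctional L) (A : Tensor3 n)
    (y : Fin n → MvPolynomial (Fin n) ℝ) (hy : ∀ l, (y l).totalDegree ≤ 2) {B q : ℝ}
    (hB : 0 < B) (hq : 0 < q) (hA : energy L A ≤ B ^ 2) (hyq : ∑ l, L (y l ^ 2) ≤ q ^ 2) :
    |L (∑ l, slicePoly A l * y l)| ≤ B * q := by
  have key : ∀ l (c : ℝ), 0 ≤ q ^ 2 * L (slicePoly A l ^ 2) + 2 * q * c * L (slicePoly A l * y l) +
      c ^ 2 * L (y l ^ 2) := fun l c => by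
    have h1 := hL.map_sq_nonneg (q • slicePoly A l + c • y l) ((totalDegree_add _ _).trans
      (max_le ((totalDegree_smul_le _ _).trans (totalDegree_slicePoly_le A l))
        ((totalDegree_smul_le _ _).trans (hy l))))
    rw [show (q • slicePoly A l + c • y l) ^ 2 = q ^ 2 • slicePoly A l ^ 2 +
        (2 * q * c) • (slicePoly A l * y l) + c ^ 2 • y l ^ 2 by
      simp only [smul_eq_C_mul, map_pow, map_mul, map_ofNat]
      ring, map_add, map_add, map_smul, map_smul, map_smul] at h1
    exact h1
  have hsum : ∀ c : ℝ, 0 ≤ q ^ 2 * energy L A + 2 * q * c * L (∑ l, slicePoly A l * y l) +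
      c ^ 2 * ∑ l, L (y l ^ 2) := fun c => by
    have := Finset.sum_nonneg fun l (_ : l ∈ Finset.univ) => key l c
    rw [Finset.sum_add_distrib, Finset.sum_add_distrib, ← Finset.mul_sum, ← Finset.mul_sum,
      ← Finset.mul_sum] at this
    rwa [map_sum]
  have h1 := hsum B
  have h2 := hsum (-B)
  have h3 : q ^ 2 * energy L A ≤ q ^ 2 * B ^ 2 := by gcongr
  have h4 : B ^ 2 * ∑ l, L (y l ^ 2) ≤ B ^ 2 * q ^ 2 := by gcongr
  have hBq : 0 < B * q := mul_pos hB hq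
  rw [abs_le]
  constructor
  · by_contra! hcon
    nlinarith
  · by_contra! hcon
    nlinarith

theorem tensorPoly_semiRandomInput (τ : ℝ) (v₀ : EuclideanSpace ℝ (Fin n)) (A : Tensor3 n)
    (Q : Matrix (Fin n) (Fin n) ℝ) :
    tensorPoly (semiRandomInput τ v₀ A Q) =
      τ • (linPoly v₀ ^ 2 * linPoly fun k => ∑ l, v₀ l * Q l k) +
        ∑ l, slicePoly A l * linPoly (Q l) := by
  have h1 : τ • (linPoly v₀ ^ 2 * linPoly fun k => ∑ l, v₀ l * Q l k) =
      ∑ i, ∑ j, ∑ k, C (∑ l, τ * (v₀ i * v₀ j * v₀ l) * Q l k) * (X i * X j * X k) := by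
    rw [sq, linPoly, linPoly, Finset.sum_mul_sum, Finset.sum_mul, Finset.smul_sum]
    refine Finset.sum_congr rfl fun i _ => ?_
    rw [Finset.sum_mul, Finset.smul_sum]
    refine Finset.sum_congr rfl fun j _ => ?_
    rw [Finset.mul_sum, Finset.smul_sum]
    refine Finset.sum_congr rfl fun k _ => ?_
    have : ∑ l, τ * (v₀ i * v₀ j * v₀ l) * Q l k = τ * v₀ i * v₀ j * ∑ l, v₀ l * Q l k := by
      rw [Finset.mul_sum]
      exact Finset.sum_congr rfl fun l _ => by ring
    rw [this]
    simp only [smul_eq_C_mul, C_mul]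
    ring
  have h2 : ∑ l, slicePoly A l * linPoly (Q l) =
      ∑ i, ∑ j, ∑ k, C (∑ l, A (i, j, l) * Q l k) * (X i * X j * X k) := by
    have h3 : ∀ l, slicePoly A l * linPoly (Q l) =
        ∑ i, ∑ j, ∑ k, C (A (i, j, l) * Q l k) * (X i * X j * X k) := fun l => by
      rw [slicePoly, linPoly, Fintype.sum_prod_type, Finset.sum_mul]
      refine Finset.sum_congr rfl fun i _ => ?_
      rw [Finset.sum_mul]
      refine Finset.sum_congr rfl fun j _ => ?_
      rw [Finset.mul_sum]
      refine Finset.sum_congr rfl fun k _ => ?_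
      simp only [smul_eq_C_mul, C_mul]
      ring
    simp_rw [h3]
    rw [Finset.sum_comm]
    refine Finset.sum_congr rfl fun i _ => ?_
    rw [Finset.sum_comm]
    refine Finset.sum_congr rfl fun j _ => ?_
    rw [Finset.sum_comm]
    refine Finset.sum_congr rfl fun k _ => ?_
    rw [map_sum, Finset.sum_mul]
  rw [h1, h2, tensorPoly]
  simp only [← Finset.sum_add_distrib, ← add_mul, ← C_add]
  refine Finset.sum_congr rfl fun i _ => Finset.sum_congr rfl fun j _ =>
    Finset.sum_congr rfl fun k _ => ?_
  simp [semiRandomInput, unflatten, flatten, spikedTensor, Matrix.mul_apply]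

theorem l2_mulVec_le (D : Matrix (Fin n) (Fin n) ℝ) (w : Fin n → ℝ) :
    l2 (D.mulVec w) ≤ opNorm D * l2 w := by
  have h1 := (Matrix.toEuclideanCLM (n := Fin n) (𝕜 := ℝ) D).le_opNorm (WithLp.toLp 2 w)
  rw [Matrix.toEuclideanCLM_toLp] at h1
  rwa [l2_eq_norm, l2_eq_norm]

/-- Each coordinate has nonnegative pseudo-variance, and the second moments sum to `1`. -/
theorem norm_pseudoMean_le_one {L₀ : PolyLE n 4 →ₗ[ℝ] ℝ} (hL : IsSphereFunctional L)
    (hLL : ∀ p h, L₀ ⟨p, h⟩ = L p) : ‖pseudoMean L₀‖ ≤ 1 := by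
  rw [EuclideanSpace.norm_eq, Real.sqrt_le_one]
  rw [← hL.sum_map_sq_X]
  refine Finset.sum_le_sum fun i _ => ?_
  have h1 := hL.map_sq_nonneg (X i - C (L (X i))) ((totalDegree_sub _ _).trans (by simp))
  rw [show (X i - C (L (X i))) ^ 2 = X i ^ 2 - (2 * L (X i)) • X i + (L (X i) ^ 2) • 1 by
    simp only [smul_eq_C_mul, map_pow, map_mul, map_ofNat]
    ring, map_add, map_sub, map_smul, map_smul, hL.map_one] at h1
  simp only [pseudoMean, hLL, Real.norm_eq_abs, sq_abs, smul_eq_mul] at h1 ⊢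
  linarith

theorem inner_pseudoMean {L₀ : PolyLE n 4 →ₗ[ℝ] ℝ} (hLL : ∀ p h, L₀ ⟨p, h⟩ = L p)
    (v₀ : EuclideanSpace ℝ (Fin n)) : inner ℝ (pseudoMean L₀) v₀ = L (linPoly v₀) := by
  simp [PiLp.inner_apply, pseudoMean, linPoly, hLL]

end Signal
-- Comparison with the planted vector and normalization.
section Recovery

variable {n : ℕ}

theorem sum_sq_mulVec_le {Q : Matrix (Fin n) (Fin n) ℝ} {δ : ℝ}
    (hQ : opNorm (1 - Q) ≤ δ) (w : Fin n → ℝ) :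
    ∑ l, (∑ r, Q l r * w r) ^ 2 ≤ (1 + δ) ^ 2 * ∑ r, w r ^ 2 := by
  have h1 : l2 (Q.mulVec w) ≤ (1 + δ) * l2 w := by
    have h2 : Q.mulVec w = w - (1 - Q).mulVec w := by
      rw [Matrix.sub_mulVec, Matrix.one_mulVec, sub_sub_cancel]
    have h3 := l2_mulVec_le (1 - Q) w
    have h4 := mul_le_mul_of_nonneg_right hQ (l2_nonneg w)
    have h5 : l2 (Q.mulVec w) ≤ l2 w + l2 ((1 - Q).mulVec w) := by
      rw [h2]
      simp only [l2_eq_norm, WithLp.toLp_sub]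
      exact norm_sub_le _ _
    linarith
  have h6 := pow_le_pow_left₀ (l2_nonneg _) h1 2
  rw [mul_pow, sq_l2, sq_l2] at h6
  exact h6

/-- For `d = (Q - 1)ᵀ v` one has `‖d‖² = ⟨v, (Q - 1) d⟩ ≤ δ ‖d‖`, which avoids the norm of the
transpose. -/
theorem sum_sq_vecMul_sub_le {Q : Matrix (Fin n) (Fin n) ℝ} {δ : ℝ}
    (hQ : opNorm (1 - Q) ≤ δ) {v : Fin n → ℝ} (hv : ∑ i, v i ^ 2 = 1) :
    ∑ k, ((∑ l, v l * Q l k) - v k) ^ 2 ≤ δ ^ 2 := by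
  set d : Fin n → ℝ := fun k => (∑ l, v l * Q l k) - v k with hd
  have hlv : l2 v = 1 := by rw [l2, hv, Real.sqrt_one]
  have h1 : l2 d ^ 2 = ∑ l, v l * -((1 - Q).mulVec d) l := by
    have h2 : ∀ l, -((1 - Q).mulVec d) l = (∑ k, Q l k * d k) - d l := fun l => by
      rw [Matrix.sub_mulVec, Matrix.one_mulVec, Pi.sub_apply, neg_sub]
      rfl
    simp_rw [h2, mul_sub, Finset.sum_sub_distrib, Finset.mul_sum]
    rw [Finset.sum_comm, sq_l2, ← Finset.sum_sub_distrib]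
    refine Finset.sum_congr rfl fun k _ => ?_
    have h3 : ∑ l, v l * (Q l k * d k) = (∑ l, v l * Q l k) * d k := by
      rw [Finset.sum_mul]
      exact Finset.sum_congr rfl fun l _ => by ring
    rw [h3, ← sub_mul, sq]
  have h4 := sum_mul_le_l2 v fun l => -((1 - Q).mulVec d) l
  have h5 : l2 (fun l => -((1 - Q).mulVec d) l) = l2 ((1 - Q).mulVec d) := by simp [l2]
  rw [← h1, h5, hlv, one_mul] at h4
  have h6 := l2_mulVec_le (1 - Q) d
  have h7 := mul_le_mul_of_nonneg_right hQ (l2_nonneg d)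
  have h0 : 0 ≤ opNorm (1 - Q) := norm_nonneg _
  have h8 : l2 d ≤ δ := by
    by_contra! hcon
    nlinarith
  have h9 := pow_le_pow_left₀ (l2_nonneg _) h8 2
  rwa [sq_l2] at h9

theorem one_sub_map_linPoly_le {v₀ : EuclideanSpace ℝ (Fin n)} (hv : ‖v₀‖ = 1) {τ δ B : ℝ}
    (hτ : 0 < τ) (hδ : 0 < δ) (hδ' : δ ≤ 1 / 2) (hB : 0 < B) {A : Tensor3 n}
    (hA : ∀ L : MvPolynomial (Fin n) ℝ →ₗ[ℝ] ℝ, IsSphereFunctional L → energy L A ≤ B ^ 2)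
    {Q : Matrix (Fin n) (Fin n) ℝ} (hQ : opNorm (1 - Q) ≤ δ) {L₀ : PolyLE n 4 →ₗ[ℝ] ℝ}
    (hmax : IsMaximizer (semiRandomInput τ v₀ A Q) L₀) {L : MvPolynomial (Fin n) ℝ →ₗ[ℝ] ℝ}
    (hL : IsSphereFunctional L) (hLL : ∀ p h, L₀ ⟨p, h⟩ = L p) :
    1 - L (linPoly v₀) ≤ 16 * δ ^ 2 + 16 * (B / τ) := by
  have hv1 : ∑ i, v₀ i ^ 2 = 1 := by
    have := EuclideanSpace.real_norm_sq_eq v₀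
    rw [hv] at this
    linarith
  set v : Fin n → ℝ := v₀.ofLp
  set d : Fin n → ℝ := fun k => (∑ l, v l * Q l k) - v k with hd
  have hdn : ∑ k, d k ^ 2 ≤ δ ^ 2 := sum_sq_vecMul_sub_le hQ hv1
  have hvd : (fun k => ∑ l, v l * Q l k) = v + d := by
    ext k
    simp [hd]
  set a := 1 + ∑ i, d i * v i with ha
  have ha' : 1 / 2 ≤ a := by
    have h1 := sum_mul_le_l2 (fun i => -d i) v
    have h2 : l2 v = 1 := by rw [l2, hv1, Real.sqrt_one]
    have h3 : l2 (fun i => -d i) ≤ δ := by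
      rw [l2]
      refine Real.sqrt_le_iff.2 ⟨hδ.le, by simpa using hdn⟩
    simp only [neg_mul, Finset.sum_neg_distrib, h2, mul_one] at h1
    linarith
  have hy : ∀ l, (linPoly (Q l)).totalDegree ≤ 2 := fun l =>
    (totalDegree_linPoly_le _).trans one_le_two
  have hnoise : ∀ L' : MvPolynomial (Fin n) ℝ →ₗ[ℝ] ℝ, IsSphereFunctional L' →
      |L' (∑ l, slicePoly A l * linPoly (Q l))| ≤ B * (1 + δ) := fun L' hL' =>
    hL'.abs_noise_le A _ hy hB (by linarith) (hA L' hL')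
      (hL'.sum_map_sq_linPoly_le Q (sum_sq_mulVec_le hQ))
  obtain ⟨E, hE, hEE⟩ := (evalAt_isFeasible hv1).exists_sphereFunctional
  have hval := hmax.2 _ (evalAt_isFeasible hv1)
  have hEv : E (linPoly v ^ 2 * linPoly (v + d)) = a := by
    have hmem : linPoly v ^ 2 * linPoly (v + d) ∈ PolyLE n 4 := by
      rw [mem_restrictTotalDegree]
      have h1 := totalDegree_mul (linPoly v ^ 2) (linPoly (v + d))
      have h2 := totalDegree_pow (linPoly v) 2
      have h3 := totalDegree_linPoly_le v
      have h4 := totalDegree_linPoly_le (v + d)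
      omega
    rw [← hEE _ hmem]
    have h5 : ∀ w : Fin n → ℝ, aeval v (linPoly w) = ∑ i, w i * v i := fun w => by
      simp [linPoly]
    simp only [LinearMap.comp_apply, Submodule.subtype_apply, AlgHom.toLinearMap_apply, map_mul,
      map_pow, h5, ← sq, hv1, Pi.add_apply, add_mul, Finset.sum_add_distrib]
    rw [ha]
    ring
  rw [hEE, hLL, tensorPoly_semiRandomInput, map_add, map_add, map_smul, map_smul, hvd, hEv,
    smul_eq_mul, smul_eq_mul] at hval
  have h1 := (abs_le.1 (hnoise E hE)).1
  have h2 := (abs_le.1 (hnoise L hL)).2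
  have h3 := hL.map_signal_le hv1 hδ hdn (by linarith)
  set m := L (linPoly v)
  have hm : 0 ≤ 1 - m := by
    have := hL.one_sub_map_sq_linPoly_le v
    have := hL.map_sq_linPoly_le_one hv1
    linarith
  have h4 : τ * a ≤ τ * (a * (1 / 4 + 3 / 4 * m) + 1 / 8 * (1 - m) + 4 * δ ^ 2) +
      2 * (B * (1 + δ)) := by
    have := mul_le_mul_of_nonneg_left h3 hτ.le
    linarith
  have h5 : a ≤ a * (1 / 4 + 3 / 4 * m) + 1 / 8 * (1 - m) + 4 * δ ^ 2 +
      2 * (B / τ) * (1 + δ) := by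
    refine le_of_mul_le_mul_left ?_ hτ
    refine h4.trans_eq ?_
    field_simp
  have h6 : 0 ≤ B / τ := by positivity
  -- By `h5`, `(3a/4 - 1/8) (1 - m) ≤ 4δ² + 2 (B/τ) (1 + δ)`; since `a ≥ 1/2`, the left factor is at
  -- least `1/4`.
  nlinarith

/-- Normalizing a vector of norm at most `1` can only increase a positive inner product. For `η ≥ 1`
the bound is at most `-1`, which also covers `x = 0`. -/
theorem one_sub_le_inner_normalize {E : Type*} [NormedAddCommGroup E] [InnerProductSpace ℝ E]
    {x v : E} {η : ℝ} (hx : ‖x‖ ≤ 1) (hv : ‖v‖ = 1) (hη : 1 - inner ℝ x v ≤ η) :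
    1 - 2 * η ≤ inner ℝ (‖x‖⁻¹ • x) v := by
  rw [real_inner_smul_left]
  have h1 := real_inner_le_norm x v
  rw [hv, mul_one] at h1
  by_cases h : 1 ≤ η
  · have h2 : |‖x‖⁻¹ * inner ℝ x v| ≤ 1 := by
      rw [← real_inner_smul_left]
      refine (abs_real_inner_le_norm _ _).trans ?_
      rw [hv, mul_one, norm_smul, norm_inv, norm_norm]
      exact inv_mul_le_one
    linarith [(abs_le.1 h2).1]
  · have h2 : 0 < inner ℝ x v := by linarith
    have h3 : 1 ≤ ‖x‖⁻¹ := (one_le_inv₀ (by linarith)).2 hx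
    nlinarith

theorem exp_neg_le (n : ℕ) (hn : 1 ≤ n) :
    Real.exp (-(2 * n)) ≤ (Nat.factorial 10 : ℝ) * (n : ℝ) ^ (-10 : ℝ) := by
  have hn0 : (0 : ℝ) < n := by exact_mod_cast hn
  have h1 := Real.pow_div_factorial_le_exp (n : ℝ) hn0.le 10
  have h2 : (n : ℝ) ^ (-10 : ℝ) = ((n : ℝ) ^ 10)⁻¹ := by
    rw [Real.rpow_neg hn0.le]
    norm_cast
  rw [h2, ← div_eq_mul_inv, le_div_iff₀ (by positivity)]
  rw [div_le_iff₀ (by positivity)] at h1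
  have h3 : Real.exp (-(2 * n)) ≤ Real.exp (-(n : ℝ)) := Real.exp_le_exp.2 (by linarith)
  calc Real.exp (-(2 * n)) * (n : ℝ) ^ 10
      ≤ Real.exp (-(n : ℝ)) * (Real.exp n * (Nat.factorial 10 : ℝ)) := by gcongr
    _ = (Nat.factorial 10 : ℝ) := by rw [← mul_assoc, ← Real.exp_add]; simp

end Recovery
end TensorPCA

/-! ### Choice of constants and conclusion. -/

theorem mainTheorem12 (C : ℝ) :
    ∃ C' K : ℝ, ∀ (n : ℕ) (v₀ : EuclideanSpace ℝ (Fin n)) (τ ε : ℝ),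
      ‖v₀‖ = 1 →
      (n : ℝ) ^ (-(1 / 2) : ℝ) ≤ ε →
      (n : ℝ) ^ (3 / 4 : ℝ) * Real.log n ^ (1 / 4 : ℝ) / ε ≤ τ →
      TensorPCA.gaussianNoise n
          {A | ¬ ∀ Q : Matrix (Fin n) (Fin n) ℝ,
            TensorPCA.opNorm (1 - Q) ≤ C * (n : ℝ) ^ (-(1 / 4) : ℝ) →
            (∃ v, TensorPCA.IsRecoveryOutput (TensorPCA.semiRandomInput τ v₀ A Q) v) ∧
            ∀ v, TensorPCA.IsRecoveryOutput (TensorPCA.semiRandomInput τ v₀ A Q) v →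
              1 - C' * ε ≤ inner ℝ v v₀}
        ≤ ENNReal.ofReal (K * (n : ℝ) ^ (-10 : ℝ)) := by
  -- The maximum keeps `δ = c n^{-1/4}` positive for every `C`.
  set c := max C 1 with hc
  have hc1 : 1 ≤ c := le_max_right _ _
  refine ⟨2 * (16 * c ^ 2 + 16 * 33), 8 * (Nat.factorial 10 : ℝ) + (16 * c ^ 4 + 3) ^ 10,
    fun n v₀ τ ε hv hε hτ => ?_⟩
  have hn : 1 ≤ n := by
    rcases Nat.eq_zero_or_pos n with rfl | h
    · rw [Subsingleton.elim v₀ 0, norm_zero] at hv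
      exact absurd hv zero_ne_one
    · exact h
  have hn0 : (0 : ℝ) < n := by exact_mod_cast hn
  have hpow : (n : ℝ) ^ (-10 : ℝ) = ((n : ℝ) ^ 10)⁻¹ := by
    rw [Real.rpow_neg hn0.le]
    norm_cast
  have hpow0 : 0 < (n : ℝ) ^ (-10 : ℝ) := Real.rpow_pos_of_pos hn0 _
  -- Below the threshold the second term of `K` makes the bound at least `1`. Above it `log n ≥ 1`
  -- and `n^{1/4} ≥ 2c`, so `δ ≤ 1/2`.
  rcases lt_or_ge (n : ℝ) (16 * c ^ 4 + 3) with hsmall | hlarge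
  · refine prob_le_one.trans ?_
    rw [← ENNReal.ofReal_one]
    refine ENNReal.ofReal_le_ofReal ?_
    have h1 : (n : ℝ) ^ 10 ≤ (16 * c ^ 4 + 3) ^ 10 := pow_le_pow_left₀ hn0.le hsmall.le 10
    have h2 : (n : ℝ) ^ 10 * (n : ℝ) ^ (-10 : ℝ) = 1 := by
      rw [hpow]
      exact mul_inv_cancel₀ (by positivity)
    have h3 : (0 : ℝ) < 8 * (Nat.factorial 10 : ℝ) := by positivity
    calc (1 : ℝ) = (n : ℝ) ^ 10 * (n : ℝ) ^ (-10 : ℝ) := h2.symm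
      _ ≤ _ := mul_le_mul_of_nonneg_right (by linarith) hpow0.le
  obtain ⟨S, hS, hSn⟩ := TensorPCA.energy_tail hn
  refine (measure_mono (fun A hA => ?_ : _ ⊆ S)).trans (hS.trans (ENNReal.ofReal_le_ofReal ?_))
  · by_contra hAS
    refine hA fun Q hQ => ?_
    have hc4 : 0 < c ^ 4 := by positivity
    have hlog : 1 ≤ Real.log n := by
      rw [Real.le_log_iff_exp_le hn0]
      linarith [Real.exp_one_lt_d9]
    set r := (n : ℝ) ^ (1 / 4 : ℝ) with hr
    have hr0 : 0 < r := Real.rpow_pos_of_pos hn0 _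
    have hr4 : r ^ 4 = n := by
      rw [hr, ← Real.rpow_natCast, ← Real.rpow_mul hn0.le]
      norm_num
    have hr3 : (n : ℝ) ^ (3 / 4 : ℝ) = r ^ 3 := by
      rw [hr, ← Real.rpow_natCast, ← Real.rpow_mul hn0.le]
      norm_num
    have hrneg : (n : ℝ) ^ (-(1 / 4) : ℝ) = r⁻¹ := Real.rpow_neg hn0.le _
    have hrneg2 : (n : ℝ) ^ (-(1 / 2) : ℝ) = (r⁻¹) ^ 2 := by
      rw [← hrneg, ← Real.rpow_natCast, ← Real.rpow_mul hn0.le]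
      norm_num
    have hsqrt : √(n : ℝ) = r ^ 2 := by
      rw [Real.sqrt_eq_iff_mul_self_eq hn0.le (by positivity), ← hr4]
      ring
    rw [hrneg2] at hε
    have hε0 : 0 < ε := lt_of_lt_of_le (by positivity) hε
    have hrc : 2 * c ≤ r := by
      by_contra! hcon
      have := pow_lt_pow_left₀ hcon hr0.le (n := 4) (by norm_num)
      rw [hr4] at this
      nlinarith
    -- The logarithmic factor is only used through being at least `1`.
    have hτ' : r ^ 3 / ε ≤ τ := by
      refine le_trans ?_ hτ
      rw [hr3]
      gcongr
      exact le_mul_of_one_le_right (by positivity) (Real.one_le_rpow hlog (by norm_num))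
    have hτ0 : 0 < τ := lt_of_lt_of_le (by positivity) hτ'
    have hδ : TensorPCA.opNorm (1 - Q) ≤ c * r⁻¹ := by
      rw [hrneg] at hQ
      exact hQ.trans (mul_le_mul_of_nonneg_right (le_max_left _ _) (by positivity))
    have hδ' : c * r⁻¹ ≤ 1 / 2 := by
      rw [← div_eq_mul_inv, div_le_iff₀ hr0]
      linarith
    have hv1 : ∑ i, v₀ i ^ 2 = 1 := by
      have := EuclideanSpace.real_norm_sq_eq v₀
      rw [hv] at this
      linarith
    have hA' : ∀ L : MvPolynomial (Fin n) ℝ →ₗ[ℝ] ℝ, TensorPCA.IsSphereFunctional L →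
        TensorPCA.energy L A ≤ (33 * r ^ 3) ^ 2 := fun L hL => by
      refine (hSn A hAS L hL).trans ?_
      rw [hsqrt, ← hr4]
      have : 0 ≤ r ^ 6 := by positivity
      -- With `n√n = r⁶`, this is `1028 ≤ 33²`.
      nlinarith
    refine ⟨?_, ?_⟩
    · obtain ⟨L, hL⟩ := TensorPCA.exists_isMaximizer (TensorPCA.semiRandomInput τ v₀ A Q) (TensorPCA.evalAt_isFeasible hv1)
      exact ⟨_, L, hL, rfl⟩
    · rintro v ⟨L₀, hL₀, rfl⟩
      obtain ⟨L, hL, hLL⟩ := hL₀.1.exists_sphereFunctional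
      have h1 := TensorPCA.one_sub_map_linPoly_le hv hτ0 (by positivity) hδ' (by positivity) hA' hδ hL₀ hL hLL
      rw [← TensorPCA.inner_pseudoMean hLL] at h1
      have h2 := TensorPCA.one_sub_le_inner_normalize (TensorPCA.norm_pseudoMean_le_one hL hLL) hv h1
      have h3 : r ^ 3 / τ ≤ ε := by
        rw [div_le_iff₀ hτ0]
        rwa [div_le_iff₀ hε0, mul_comm] at hτ'
      -- The assumption `ε ≥ n^{-1/2} = r⁻²` absorbs the second-order error here.
      have h4 : (c * r⁻¹) ^ 2 ≤ c ^ 2 * ε := by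
        rw [mul_pow]
        gcongr
      have h5 : 33 * r ^ 3 / τ = 33 * (r ^ 3 / τ) := by ring
      rw [h5] at h2
      linarith
  · have h1 := TensorPCA.exp_neg_le n hn
    have h2 : 0 ≤ (16 * c ^ 4 + 3) ^ 10 * (n : ℝ) ^ (-10 : ℝ) := by positivity
    linarith
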